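/- Let $\mathcal H$ be a separable complex Hilbert space, $\mathfrak T(\mathcal H)$ the space of trace-class operators on $\mathcal H$ with the trace norm, and $\mathfrak T_+(\mathcal H)$ its cone of positive operators. For $\rho\in\mathfrak T_+(\mathcal H)$ let $H(\rho)=[\mathrm{Tr}\rho]\,H(\rho/\mathrm{Tr}\rho)\in[0,+\infty]$ (with $H(0)=0$) be the homogeneous extension of the von Neumann entropy $H(\sigma)=\mathrm{Tr}(-\sigma\log\sigma)$ of states $\sigma$. For $k\in\mathbb N=\{1,2,\dots\}$ let $$H_k(\rho)=\sup\sum_i\pi_iH(\rho_i),$$ where the supremum is over all countable ensembles, i.e. probability distributions $\{\pi_i\}$ and operators $\rho_i\in\mathfrak T_+(\mathcal H)$ of rank $\le k$, with $\sum_i\pi_i\rho_i=\rho$ (this supremum is finite), and let $\Delta_k(\rho)=H(\rho)-H_k(\rho)\in[0,+\infty]$. For a sequence $\{\rho_n\}\subset\mathfrak T_+(\mathcal H)$ converging in trace norm to an operator $\rho_0$, put $\mathrm{dj}\{H(\rho_n)\}=\limsup_{n\to\infty}H(\rho_n)-H(\rho_0)$ if $H(\rho_0)<+\infty$, and $\mathrm{dj}\{H(\rho_n)\}=+\infty$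 if $H(\rho_0)=+\infty$. A) If $H(\rho_0)<+\infty$ then $\mathrm{dj}\{H(\rho_n)\}=\limsup_{n\to\infty}\Delta_k(\rho_n)-\Delta_k(\rho_0)$ for every $k$, and $$\mathrm{dj}\{H(\rho_n)\}=\lim_{k\to\infty}\limsup_{n\to\infty}\Delta_k(\rho_n)=\inf_k\limsup_{n\to\infty}\Delta_k(\rho_n).$$ B) Let $\mathcal K$ be a separable complex Hilbert space. Let $\Phi_n$ ($n\ge1$) and $\Phi_0$ be quantum operations, i.e. completely positive trace non-increasing linear maps $\mathfrak T(\mathcal H)\to\mathfrak T(\mathcal K)$. Assume that the Choi ranks of the $\Phi_n$, $n\ge1$, are bounded by some finite $m$ (the Choi rank of $\Phi$ is the minimal dimension of a space $E$ such that $\Phi(A)=\mathrm{Tr}_E VAV^*$ for some bounded operator $V:\mathcal H\to\mathcal K\otimes E$), and that $\Phi_n(\rho_n)$ converges to $\Phi_0(\rho_0)$ in trace norm. Then $\mathrm{dj}\{H(\Phi_n(\rho_n))\}\le\mathrm{dj}\{H(\rho_n)\}$, whether or not $H(\rho_0)$ is finite. -/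

import Mathlib

open Filter Topology
open scoped ENNReal NNReal ComplexOrder InnerProductSpace

namespace EntropyLoss

noncomputable section

/-- The trace `∑ i, ⟨e i, A (e i)⟩ ∈ [0, ∞]` of a positive bounded operator `A`, computed in an
orthonormal (Hilbert) basis `e`; for positive `A` the value does not depend on the basis. -/
def posTrace {H : Type*} [NormedAddCommGroup H] [InnerProductSpace ℂ H] [CompleteSpace H]
    (A : H →L[ℂ] H) : ℝ≥0∞ :=
  ∑' e : (exists_hilbertBasis ℂ H).choose, ENNReal.ofReal (RCLike.re ⟪(e : H), A (e : H)⟫_ℂ)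

/-- The trace norm `Tr |A|`, where `|A| = √(A* A)`. -/
def traceNorm {H : Type*} [NormedAddCommGroup H] [InnerProductSpace ℂ H] [CompleteSpace H]
    (A : H →L[ℂ] H) : ℝ≥0∞ :=
  posTrace (CFC.abs A)

/-- The space of trace-class operators: the linear span of the positive bounded operators
with finite trace. -/
def TraceClass (H : Type*) [NormedAddCommGroup H] [InnerProductSpace ℂ H] [CompleteSpace H] :
    Submodule ℂ (H →L[ℂ] H) :=
  Submodule.span ℂ {A | A.IsPositive ∧ posTrace A < ⊤}

/-- The cone of positive operators in the space of trace-class operators. -/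
def posCone (H : Type*) [NormedAddCommGroup H] [InnerProductSpace ℂ H] [CompleteSpace H] :
    Set (TraceClass H) :=
  {A | (A : H →L[ℂ] H).IsPositive}

/-- Convergence of a sequence of trace-class operators in the trace norm. -/
def TraceTendsto {H : Type*} [NormedAddCommGroup H] [InnerProductSpace ℂ H] [CompleteSpace H]
    (A : ℕ → TraceClass H) (A₀ : TraceClass H) : Prop :=
  Tendsto (fun n => traceNorm ((A n : H →L[ℂ] H) - (A₀ : H →L[ℂ] H))) atTop (𝓝 0)

/-- The von Neumann entropy `H(ρ) = Tr η(ρ)` of a state, with `η x = - x log x`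
(natural logarithm). -/
def stateEntropy {H : Type*} [NormedAddCommGroup H] [InnerProductSpace ℂ H] [CompleteSpace H]
    (ρ : H →L[ℂ] H) : ℝ≥0∞ :=
  posTrace (cfc Real.negMulLog ρ)

/-- The homogeneous extension `H(ρ) = [Tr ρ] H(ρ / Tr ρ)` of the von Neumann entropy to the cone
of positive trace-class operators (equal to `0` at `ρ = 0`). -/
def entropy {H : Type*} [NormedAddCommGroup H] [InnerProductSpace ℂ H] [CompleteSpace H]
    (ρ : TraceClass H) : ℝ≥0∞ :=
  posTrace (ρ : H →L[ℂ] H) *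
    stateEntropy ((posTrace (ρ : H →L[ℂ] H)).toReal⁻¹ • (ρ : H →L[ℂ] H))

/-- The countable ensembles `{π i, σ i}` of positive trace-class operators of rank at most `k`
with average `ρ`: `π` is a probability distribution and `∑ i, π i • σ i = ρ` in trace norm.
(Finite ensembles are included, with `π i = 0` for all but finitely many `i`.) -/
def ensembles {H : Type*} [NormedAddCommGroup H] [InnerProductSpace ℂ H] [CompleteSpace H]
    (k : ℕ) (ρ : TraceClass H) : Set ((ℕ → ℝ≥0) × (ℕ → TraceClass H)) :=
  {e | HasSum e.1 1 ∧
    (∀ i, e.2 i ∈ posCone H ∧ ((e.2 i : H →L[ℂ] H) : H →ₗ[ℂ] H).rank ≤ (k : Cardinal)) ∧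
    TraceTendsto (fun N => ∑ i ∈ Finset.range N, ((e.1 i : ℝ) : ℂ) • e.2 i) ρ}

/-- The `k`-approximator `H_k(ρ) = sup ∑ i, π i * H(σ i)` of the entropy, the supremum being over
all countable ensembles of positive trace-class operators of rank `≤ k` with average `ρ`. -/
def approximator {H : Type*} [NormedAddCommGroup H] [InnerProductSpace ℂ H] [CompleteSpace H]
    (k : ℕ) (ρ : TraceClass H) : ℝ≥0∞ :=
  ⨆ e ∈ ensembles k ρ, ∑' i, (e.1 i : ℝ≥0∞) * entropy (e.2 i)

/-- The gap `Δ_k(ρ) = H(ρ) - H_k(ρ)` (for `k ≥ 1` the value `H_k(ρ) ≤ [Tr ρ] log k` is finite). -/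
def gap {H : Type*} [NormedAddCommGroup H] [InnerProductSpace ℂ H] [CompleteSpace H]
    (k : ℕ) (ρ : TraceClass H) : EReal :=
  (entropy ρ : EReal) - (approximator k ρ : EReal)

open Classical in
/-- The entropy loss (discontinuity jump) `dj{H(ρ n)} = limsup H(ρ n) - H(ρ₀)`, which is `+∞` by
convention if `H(ρ₀) = +∞`. -/
def entropyJump {H : Type*} [NormedAddCommGroup H] [InnerProductSpace ℂ H] [CompleteSpace H]
    (ρ : ℕ → TraceClass H) (ρ₀ : TraceClass H) : EReal :=
  if entropy ρ₀ = ⊤ then ⊤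
  else limsup (fun n => (entropy (ρ n) : EReal)) atTop - (entropy ρ₀ : EReal)

/-- A matrix of trace-class operators is positive as an operator on `H ⊗ ℂⁿ = H ⊕ ⋯ ⊕ H`. -/
def BlockPositive {H : Type*} [NormedAddCommGroup H] [InnerProductSpace ℂ H] [CompleteSpace H]
    {n : ℕ} (A : Fin n → Fin n → TraceClass H) : Prop :=
  ∀ x : Fin n → H, 0 ≤ ∑ i, ∑ j, ⟪x i, (A i j : H →L[ℂ] H) (x j)⟫_ℂ

/-- A quantum operation: a completely positive trace non-increasing linear map between spaces of
trace-class operators. -/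
structure QuantumOperation (H K : Type*)
    [NormedAddCommGroup H] [InnerProductSpace ℂ H] [CompleteSpace H]
    [NormedAddCommGroup K] [InnerProductSpace ℂ K] [CompleteSpace K] where
  toLinearMap : TraceClass H →ₗ[ℂ] TraceClass K
  completelyPositive : ∀ (n : ℕ) (A : Fin n → Fin n → TraceClass H),
    BlockPositive A → BlockPositive (fun i j => toLinearMap (A i j))
  trace_le : ∀ A ∈ posCone H,
    posTrace (toLinearMap A : K →L[ℂ] K) ≤ posTrace (A : H →L[ℂ] H)

/-- The partial trace over `ℂᵐ` of an operator on `K ⊗ ℂᵐ`, realised as the Hilbert sum of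
`m` copies of `K`: the sum of the diagonal blocks. -/
def partialTrace {K : Type*} [NormedAddCommGroup K] [InnerProductSpace ℂ K] [CompleteSpace K]
    {m : ℕ} (T : PiLp 2 (fun _ : Fin m => K) →L[ℂ] PiLp 2 (fun _ : Fin m => K)) : K →L[ℂ] K :=
  ∑ j : Fin m, PiLp.proj 2 (𝕜 := ℂ) (fun _ : Fin m => K) j ∘L T ∘L
    ContinuousLinearMap.adjoint (PiLp.proj 2 (𝕜 := ℂ) (fun _ : Fin m => K) j)

/-- `Φ(A) = Tr_E V A V*` for some bounded `V : H → K ⊗ E` with `E = ℂᵐ`. -/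
def HasStinespring {H K : Type*}
    [NormedAddCommGroup H] [InnerProductSpace ℂ H] [CompleteSpace H]
    [NormedAddCommGroup K] [InnerProductSpace ℂ K] [CompleteSpace K]
    (Φ : QuantumOperation H K) (m : ℕ) : Prop :=
  ∃ V : H →L[ℂ] PiLp 2 (fun _ : Fin m => K), ∀ A : TraceClass H,
    (Φ.toLinearMap A : K →L[ℂ] K) =
      partialTrace (V ∘L (A : H →L[ℂ] H) ∘L ContinuousLinearMap.adjoint V)

/-- The Choi rank: the minimal dimension of the space `E` in a Stinespring representation
(`⊤` if there is none with finite-dimensional `E`). -/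
def choiRank {H K : Type*}
    [NormedAddCommGroup H] [InnerProductSpace ℂ H] [CompleteSpace H]
    [NormedAddCommGroup K] [InnerProductSpace ℂ K] [CompleteSpace K]
    (Φ : QuantumOperation H K) : ℕ∞ :=
  ⨅ (m : ℕ) (_ : HasStinespring Φ m), (m : ℕ∞)

end

end EntropyLoss

set_option linter.unusedSectionVars false

namespace EntropyLoss

noncomputable section

variable {H : Type*} [NormedAddCommGroup H] [InnerProductSpace ℂ H] [CompleteSpace H]
  {K : Type*} [NormedAddCommGroup K] [InnerProductSpace ℂ K] [CompleteSpace K]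

open ContinuousLinearMap (adjoint)

/-! ### Quadratic forms and traces of positive operators -/

/-! The entropy of a positive trace-class `A` is the minimum of `∑ ‖v x‖² (-log r x)` over families
with `∑ |v x⟩⟨v x| = A` and weights `∑ r x ≤ 1`. Gibbs' inequality gives the bound
(`ent_le_of_frame`), and the spectral data attain it (`exists_ent_eq`). Inserting the minimiser of
one operator into the bound for another yields every entropy inequality needed: monotonicity,
superadditivity, subadditivity up to `Tr A (-log p) + Tr B (-log q)` with `p + q ≤ 1`, the bound `Tr
A log k` for rank `k`, and a Kraus bound with error `Tr A` times the logarithm of the number of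
operators.

Statement A rests on two facts. Each `H_k` is continuous in trace norm (`tendsto_appr_of_tendsto`),
because a perturbation of a decomposition keeps rank at most `k`, so its entropy is at most its
small trace times a constant. And `H_k` increases to `H` (`tendsto_appr`), by spectral truncation.
Hence `limsup Δ_k(ρ_n) = limsup H(ρ_n) - H_k(ρ₀)`, and A follows by arithmetic and by letting `k`
grow.

For B, let `P` project onto finitely many eigenvectors of `ρ₀`, and split `ρ_n = α + β` with `α =
√ρ_n P √ρ_n`. The entropy of `α` is at least that of `P ρ_n P`, hence nearly at least `H(ρ₀)`, and
`H(α) + H(β) ≤ H(ρ_n)`. The image of `α` has rank bounded uniformly in `n`, so its entropy is at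
most `H_N(Φ_n(ρ_n))`, which converges to `H_N(Φ₀(ρ₀)) ≤ H(Φ₀(ρ₀))`. The image of `β` has entropy at
most `H(β)` plus a small error, since `Tr β` is small and there are boundedly many Kraus operators.
Adding up (`ent_diagOp_add_ent_krausMap_le`) gives `H(ρ₀) + limsup H(Φ_n(ρ_n)) ≤ H(Φ₀(ρ₀)) + limsup
H(ρ_n)`. To subtract, `H(Φ₀(ρ₀))` must be finite when `limsup H(ρ_n)` is; this is
`ent_le_limsup_of_krausMap`. -/

/-- The quadratic form `⟨x, A x⟩` of a positive operator, as an extended nonnegative real. -/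
def quadForm (A : H →L[ℂ] H) (x : H) : ℝ≥0∞ := ENNReal.ofReal (RCLike.re ⟪x, A x⟫_ℂ)

lemma posTrace_def (A : H →L[ℂ] H) :
    posTrace A = ∑' e : (exists_hilbertBasis ℂ H).choose, quadForm A (e : H) := rfl

lemma quadForm_ne_top (A : H →L[ℂ] H) (x : H) : quadForm A x ≠ ⊤ := ENNReal.ofReal_ne_top

lemma enorm_sq_eq_ofReal {E : Type*} [NormedAddCommGroup E] (x : E) :
    ‖x‖ₑ ^ 2 = ENNReal.ofReal (‖x‖ ^ 2) := by
  rw [ENNReal.ofReal_pow (norm_nonneg _), ofReal_norm]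

/-- Parseval's identity. -/
lemma tsum_enorm_inner_sq {ι : Type*} (b : HilbertBasis ι ℂ H) (x : H) :
    ∑' i, ‖⟪b i, x⟫_ℂ‖ₑ ^ 2 = ‖x‖ₑ ^ 2 := by
  have h := b.hasSum_inner_mul_inner x x
  have h2 : HasSum (fun i => ‖⟪b i, x⟫_ℂ‖ ^ 2) (‖x‖ ^ 2) := by
    have h3 := (Complex.hasSum_re h)
    convert h3 using 1
    · ext i
      rw [← inner_conj_symm x (b i), ← Complex.normSq_eq_conj_mul_self, Complex.ofReal_re,
        Complex.normSq_eq_norm_sq]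
    · exact (inner_self_eq_norm_sq (𝕜 := ℂ) x).symm
  simp_rw [enorm_sq_eq_ofReal]
  rw [← ENNReal.ofReal_tsum_of_nonneg (fun i => by positivity) h2.summable, h2.tsum_eq]

lemma tsum_enorm_inner_sq' {ι : Type*} (b : HilbertBasis ι ℂ H) (x : H) :
    ∑' i, ‖⟪x, b i⟫_ℂ‖ₑ ^ 2 = ‖x‖ₑ ^ 2 := by
  rw [← tsum_enorm_inner_sq b x]
  refine tsum_congr fun i => ?_
  rw [← inner_conj_symm, enorm_sq_eq_ofReal, enorm_sq_eq_ofReal, RCLike.norm_conj]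

/-- The Hilbert-Schmidt norm of an operator and of its adjoint agree. -/
lemma tsum_enorm_sq_adjoint {ι κ : Type*} (b : HilbertBasis ι ℂ H) (c : HilbertBasis κ ℂ K)
    (B : H →L[ℂ] K) : ∑' i, ‖B (b i)‖ₑ ^ 2 = ∑' j, ‖adjoint B (c j)‖ₑ ^ 2 := by
  simp_rw [← tsum_enorm_inner_sq c, ← tsum_enorm_inner_sq' b]
  rw [ENNReal.tsum_comm]
  simp_rw [ContinuousLinearMap.adjoint_inner_left]

lemma isPositive_sqrt (A : H →L[ℂ] H) : (CFC.sqrt A).IsPositive :=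
  (ContinuousLinearMap.nonneg_iff_isPositive _).1 (CFC.sqrt_nonneg A)

lemma sqrt_comp_sqrt {A : H →L[ℂ] H} (hA : A.IsPositive) : CFC.sqrt A ∘L CFC.sqrt A = A :=
  CFC.sqrt_mul_sqrt_self A ((ContinuousLinearMap.nonneg_iff_isPositive _).2 hA)

lemma adjoint_sqrt (A : H →L[ℂ] H) : adjoint (CFC.sqrt A) = CFC.sqrt A :=
  (isPositive_sqrt A).isSelfAdjoint.adjoint_eq

lemma ofReal_re_inner_self (x : H) : ENNReal.ofReal (RCLike.re ⟪x, x⟫_ℂ) = ‖x‖ₑ ^ 2 := by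
  rw [inner_self_eq_norm_sq, enorm_sq_eq_ofReal]

lemma quadForm_adjoint_comp (B : H →L[ℂ] K) (x : H) :
    quadForm (adjoint B ∘L B) x = ‖B x‖ₑ ^ 2 := by
  rw [quadForm, ContinuousLinearMap.comp_apply, ContinuousLinearMap.adjoint_inner_right,
    ofReal_re_inner_self]

lemma quadForm_eq_sqrt {A : H →L[ℂ] H} (hA : A.IsPositive) (x : H) :
    quadForm A x = ‖CFC.sqrt A x‖ₑ ^ 2 := by
  rw [← quadForm_adjoint_comp, adjoint_sqrt, sqrt_comp_sqrt hA]

lemma quadForm_conj (A : H →L[ℂ] H) (B : H →L[ℂ] K) (x : K) :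
    quadForm (B ∘L A ∘L adjoint B) x = quadForm A (adjoint B x) := by
  simp [quadForm, ContinuousLinearMap.adjoint_inner_left]

lemma quadForm_add {A B : H →L[ℂ] H} (hA : A.IsPositive) (hB : B.IsPositive) (x : H) :
    quadForm (A + B) x = quadForm A x + quadForm B x := by
  rw [quadForm, quadForm, quadForm, ← ENNReal.ofReal_add (hA.re_inner_nonneg_right x)
    (hB.re_inner_nonneg_right x)]
  simp

lemma quadForm_smul (c : ℝ≥0) (A : H →L[ℂ] H) (x : H) :
    quadForm (((c : ℝ) : ℂ) • A) x = c * quadForm A x := by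
  have : RCLike.re ⟪x, (((c : ℝ) : ℂ) • A) x⟫_ℂ = c * RCLike.re ⟪x, A x⟫_ℂ := by
    simp
  rw [quadForm, quadForm, this, ENNReal.ofReal_mul (NNReal.coe_nonneg c), ENNReal.ofReal_coe_nnreal]

@[simp] lemma quadForm_zero (x : H) : quadForm (0 : H →L[ℂ] H) x = 0 := by simp [quadForm]

lemma isPositive_smul {A : H →L[ℂ] H} (hA : A.IsPositive) (c : ℝ≥0) :
    (((c : ℝ) : ℂ) • A).IsPositive :=
  hA.smul_of_nonneg (by exact_mod_cast c.2)

lemma quadForm_mono {A B : H →L[ℂ] H} (h : A ≤ B) (x : H) : quadForm A x ≤ quadForm B x := by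
  have := (ContinuousLinearMap.le_def _ _).1 h
  have h2 := this.re_inner_nonneg_right x
  refine ENNReal.ofReal_le_ofReal ?_
  simpa [inner_sub_right] using h2

lemma isPositive_mono {A B : H →L[ℂ] H} (h : A ≤ B) (hA : A.IsPositive) : B.IsPositive := by
  rw [← ContinuousLinearMap.nonneg_iff_isPositive] at *
  exact hA.trans h

lemma isPositive_of_selfAdjoint {A : H →L[ℂ] H} (hA : IsSelfAdjoint A)
    (h : ∀ x, 0 ≤ RCLike.re ⟪x, A x⟫_ℂ) : A.IsPositive := by
  rw [ContinuousLinearMap.isPositive_def']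
  refine ⟨hA, fun x => ?_⟩
  rw [ContinuousLinearMap.reApplyInnerSelf_apply, inner_re_symm]
  exact h x

lemma le_of_quadForm_le {A B : H →L[ℂ] H} (hA : A.IsPositive) (hB : B.IsPositive)
    (h : ∀ x, quadForm A x ≤ quadForm B x) : A ≤ B := by
  rw [ContinuousLinearMap.le_def]
  refine isPositive_of_selfAdjoint (hB.isSelfAdjoint.sub hA.isSelfAdjoint) fun x => ?_
  have := (ENNReal.ofReal_le_ofReal_iff (hB.re_inner_nonneg_right x)).1 (h x)
  simpa [inner_sub_right] using this

/-- The trace of a positive operator can be computed in every Hilbert basis. -/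
lemma posTrace_eq_tsum {A : H →L[ℂ] H} (hA : A.IsPositive) {ι : Type*} (b : HilbertBasis ι ℂ H) :
    posTrace A = ∑' i, quadForm A (b i) := by
  obtain ⟨c, hc⟩ := (exists_hilbertBasis ℂ H).choose_spec
  rw [posTrace_def]
  simp_rw [quadForm_eq_sqrt hA]
  have h := tsum_enorm_sq_adjoint b c (CFC.sqrt A)
  rw [hc, adjoint_sqrt] at h
  exact h.symm

lemma posTrace_comm {ι κ : Type*} (b : HilbertBasis ι ℂ H) (c : HilbertBasis κ ℂ K)
    (B : H →L[ℂ] K) : posTrace (adjoint B ∘L B) = posTrace (B ∘L adjoint B) := by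
  rw [posTrace_eq_tsum (ContinuousLinearMap.isPositive_adjoint_comp_self B) b,
    posTrace_eq_tsum (ContinuousLinearMap.isPositive_self_comp_adjoint B) c]
  simp_rw [quadForm_adjoint_comp]
  rw [tsum_enorm_sq_adjoint b c]
  refine tsum_congr fun j => ?_
  rw [← quadForm_adjoint_comp, ContinuousLinearMap.adjoint_adjoint]

lemma posTrace_mono_quadForm {A B : H →L[ℂ] H} (h : ∀ x, quadForm A x ≤ quadForm B x) :
    posTrace A ≤ posTrace B :=
  ENNReal.tsum_le_tsum fun _ => h _

lemma posTrace_mono {A B : H →L[ℂ] H} (h : A ≤ B) : posTrace A ≤ posTrace B :=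
  posTrace_mono_quadForm (quadForm_mono h)

lemma posTrace_add {A B : H →L[ℂ] H} (hA : A.IsPositive) (hB : B.IsPositive) :
    posTrace (A + B) = posTrace A + posTrace B := by
  simp_rw [posTrace_def, quadForm_add hA hB, ENNReal.tsum_add]

lemma posTrace_smul (c : ℝ≥0) (A : H →L[ℂ] H) :
    posTrace (((c : ℝ) : ℂ) • A) = c * posTrace A := by
  simp_rw [posTrace_def, quadForm_smul, ENNReal.tsum_mul_left]

@[simp] lemma posTrace_zero : posTrace (0 : H →L[ℂ] H) = 0 := by
  simp [posTrace_def]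

lemma posTrace_tsum {ι : Type*} {τ : ι → H →L[ℂ] H} {A : H →L[ℂ] H}
    (h : ∀ x, ∑' i, quadForm (τ i) x = quadForm A x) : ∑' i, posTrace (τ i) = posTrace A := by
  simp_rw [posTrace_def, ← h]
  exact ENNReal.tsum_comm

/-- Each coordinate of `√A x` is an inner product of `x` with `√A (c i)`; Cauchy–Schwarz, summed
over the basis, gives the trace. -/
lemma quadForm_le_posTrace {A : H →L[ℂ] H} (hA : A.IsPositive) (x : H) :
    quadForm A x ≤ posTrace A * ‖x‖ₑ ^ 2 := by
  obtain ⟨c, hc⟩ := (exists_hilbertBasis ℂ H).choose_spec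
  rw [posTrace_eq_tsum hA c, quadForm_eq_sqrt hA, ← tsum_enorm_inner_sq c, ← ENNReal.tsum_mul_right]
  refine ENNReal.tsum_le_tsum fun i => ?_
  rw [quadForm_eq_sqrt hA, ← mul_pow,
    ← ContinuousLinearMap.adjoint_inner_left, adjoint_sqrt]
  gcongr
  rw [← ofReal_norm, ← ofReal_norm, ← ofReal_norm,
    ← ENNReal.ofReal_mul (norm_nonneg _)]
  exact ENNReal.ofReal_le_ofReal (norm_inner_le_norm _ _)

/-! ### Absolute values -/

lemma isPositive_abs (A : H →L[ℂ] H) : (CFC.abs A).IsPositive :=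
  (ContinuousLinearMap.nonneg_iff_isPositive _).1 (CFC.abs_nonneg A)

lemma le_abs_self {A : H →L[ℂ] H} (hA : IsSelfAdjoint A) : A ≤ CFC.abs A := by
  rw [← sub_nonneg, CFC.abs_sub_self A hA]
  exact nsmul_nonneg (CFC.negPart_nonneg A) 2

lemma norm_le_traceNorm (A : H →L[ℂ] H) : ‖A‖ₑ ≤ traceNorm A := by
  rw [← ofReal_norm, ← CFC.norm_abs (a := A), traceNorm]
  rcases eq_or_ne (posTrace (CFC.abs A)) ⊤ with h | h
  · simp [h]
  rw [ENNReal.ofReal_le_iff_le_toReal h]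
  set P := CFC.abs A with hP
  have hPpos : P.IsPositive := isPositive_abs A
  set t := (posTrace P).toReal with ht
  have h1 : ‖CFC.sqrt P‖ ≤ √t := by
    refine ContinuousLinearMap.opNorm_le_bound _ (Real.sqrt_nonneg _) fun x => ?_
    have := quadForm_le_posTrace hPpos x
    rw [quadForm_eq_sqrt hPpos, ← ENNReal.ofReal_toReal h, enorm_sq_eq_ofReal, enorm_sq_eq_ofReal,
      ← ENNReal.ofReal_mul ENNReal.toReal_nonneg, ENNReal.ofReal_le_ofReal_iff (by positivity)]
      at this
    rw [← Real.sqrt_sq (norm_nonneg x), ← Real.sqrt_mul ENNReal.toReal_nonneg]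
    exact Real.le_sqrt_of_sq_le this
  calc ‖P‖ = ‖CFC.sqrt P ∘L CFC.sqrt P‖ := by rw [sqrt_comp_sqrt hPpos]
    _ ≤ ‖CFC.sqrt P‖ * ‖CFC.sqrt P‖ := ContinuousLinearMap.opNorm_comp_le _ _
    _ ≤ √t * √t := by gcongr
    _ = t := Real.mul_self_sqrt ENNReal.toReal_nonneg

lemma traceNorm_of_isPositive {A : H →L[ℂ] H} (hA : A.IsPositive) : traceNorm A = posTrace A := by
  rw [traceNorm, CFC.abs_of_nonneg A ((ContinuousLinearMap.nonneg_iff_isPositive _).2 hA)]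

lemma traceNorm_neg (A : H →L[ℂ] H) : traceNorm (-A) = traceNorm A := by
  rw [traceNorm, CFC.abs_neg, traceNorm]

/-- Domination of the quadratic form by a positive operator of finite trace survives linear
combinations, so it passes from the generators to the span. -/
lemma exists_isPositive_of_mem_traceClass {A : H →L[ℂ] H} (hA : A ∈ TraceClass H) :
    ∃ P : H →L[ℂ] H, P.IsPositive ∧ posTrace P < ⊤ ∧ ∀ x, ‖⟪x, A x⟫_ℂ‖ₑ ≤ quadForm P x := by
  induction hA using Submodule.span_induction with
  | mem A h =>
    refine ⟨A, h.1, h.2, fun x => ?_⟩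
    have h1 := h.1.inner_nonneg_right x
    rw [← ofReal_norm, quadForm]
    refine ENNReal.ofReal_le_ofReal ?_
    exact (congrArg RCLike.re (RCLike.norm_of_nonneg' h1)).le
  | zero => exact ⟨0, ContinuousLinearMap.isPositive_zero, by simp, by simp⟩
  | add A B _ _ hA hB =>
    obtain ⟨P, hP, hPt, hPA⟩ := hA
    obtain ⟨Q, hQ, hQt, hQB⟩ := hB
    refine ⟨P + Q, hP.add hQ, ?_, fun x => ?_⟩
    · rw [posTrace_add hP hQ]; exact ENNReal.add_lt_top.2 ⟨hPt, hQt⟩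
    · rw [quadForm_add hP hQ, add_apply, inner_add_right]
      exact (enorm_add_le _ _).trans (add_le_add (hPA x) (hQB x))
  | smul c A _ hA =>
    obtain ⟨P, hP, hPt, hPA⟩ := hA
    refine ⟨((‖c‖₊ : ℝ) : ℂ) • P, isPositive_smul hP _, ?_, fun x => ?_⟩
    · rw [posTrace_smul]; exact ENNReal.mul_lt_top ENNReal.coe_lt_top hPt
    · rw [quadForm_smul, smul_apply, inner_smul_right, enorm_mul]
      gcongr
      · exact le_rfl
      · exact hPA x

lemma posTrace_lt_top_of_mem {A : H →L[ℂ] H} (hA : A ∈ TraceClass H) :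
    posTrace A < ⊤ := by
  obtain ⟨P, hP, hPt, hPA⟩ := exists_isPositive_of_mem_traceClass hA
  refine (posTrace_mono_quadForm fun x => le_trans ?_ (hPA x)).trans_lt hPt
  rw [← ofReal_norm, quadForm]
  exact ENNReal.ofReal_le_ofReal (RCLike.re_le_norm _)

lemma mem_traceClass {A : H →L[ℂ] H} (hp : A.IsPositive) (hA : posTrace A < ⊤) :
    A ∈ TraceClass H :=
  Submodule.subset_span ⟨hp, hA⟩

/-! ### The spectral decomposition of positive trace-class operators -/

/-- The operator `∑ i ∈ F, c i |b i⟩⟨b i|`. -/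
def diagOp {ι : Type*} (b : HilbertBasis ι ℂ H) (F : Finset ι) (c : ι → ℝ≥0) : H →L[ℂ] H :=
  ∑ i ∈ F, ((c i : ℝ) : ℂ) • InnerProductSpace.rankOne ℂ (b i) (b i)

lemma diagOp_apply {ι : Type*} (b : HilbertBasis ι ℂ H) (F : Finset ι) (c : ι → ℝ≥0) (x : H) :
    diagOp b F c x = ∑ i ∈ F, ((c i : ℝ) : ℂ) • ⟪b i, x⟫_ℂ • b i := by
  simp [diagOp]

lemma inner_diagOp {ι : Type*} [DecidableEq ι] (b : HilbertBasis ι ℂ H) (F : Finset ι)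
    (c : ι → ℝ≥0) (x : H) (j : ι) :
    ⟪b j, diagOp b F c x⟫_ℂ = if j ∈ F then ((c j : ℝ) : ℂ) * ⟪b j, x⟫_ℂ else 0 := by
  rw [diagOp_apply, inner_sum]
  simp_rw [inner_smul_right, orthonormal_iff_ite.1 b.orthonormal]
  simp

lemma diagOp_basis {ι : Type*} [DecidableEq ι] (b : HilbertBasis ι ℂ H) (F : Finset ι)
    (c : ι → ℝ≥0) (j : ι) :
    diagOp b F c (b j) = if j ∈ F then ((c j : ℝ) : ℂ) • b j else 0 := by
  rw [diagOp_apply]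
  simp_rw [orthonormal_iff_ite.1 b.orthonormal]
  simp

lemma isPositive_diagOp {ι : Type*} (b : HilbertBasis ι ℂ H) (F : Finset ι) (c : ι → ℝ≥0) :
    (diagOp b F c).IsPositive :=
  ContinuousLinearMap.isPositive_sum _ fun i _ =>
    isPositive_smul (InnerProductSpace.isPositive_rankOne_self (b i)) (c i)

lemma adjoint_diagOp {ι : Type*} (b : HilbertBasis ι ℂ H) (F : Finset ι) (c : ι → ℝ≥0) :
    adjoint (diagOp b F c) = diagOp b F c :=
  (isPositive_diagOp b F c).isSelfAdjoint.adjoint_eq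

lemma isCompactOperator_diagOp {ι : Type*} (b : HilbertBasis ι ℂ H) (F : Finset ι)
    (c : ι → ℝ≥0) : IsCompactOperator (diagOp b F c) := by
  classical
  induction F using Finset.induction_on with
  | empty => simpa [diagOp] using isCompactOperator_zero
  | insert i F hi ih =>
    have h1 : IsCompactOperator
        (((c i : ℝ) : ℂ) • InnerProductSpace.rankOne ℂ (b i) (b i) : H →L[ℂ] H) := by
      have h2 : IsCompactOperator (ContinuousLinearMap.toSpanSingleton ℂ
          (((c i : ℝ) : ℂ) • b i)) :=
        isCompactOperator_of_locallyCompactSpace_rng _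
      have h3 := h2.comp_clm (innerSL ℂ (b i))
      have h4 : ⇑(((c i : ℝ) : ℂ) • InnerProductSpace.rankOne ℂ (b i) (b i) : H →L[ℂ] H) =
          ContinuousLinearMap.toSpanSingleton ℂ (((c i : ℝ) : ℂ) • b i) ∘ innerSL ℂ (b i) := by
        ext x
        simpa using smul_comm _ _ _
      rwa [h4]
    have h4 : diagOp b (insert i F) c =
        ((c i : ℝ) : ℂ) • InnerProductSpace.rankOne ℂ (b i) (b i) + diagOp b F c := by
      rw [diagOp, Finset.sum_insert hi, diagOp]
    rw [h4]
    exact h1.add ih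

lemma enorm_apply_sq_le {A : H →L[ℂ] H} (hA : A.IsPositive) (x : H) :
    ‖A x‖ₑ ^ 2 ≤ ‖CFC.sqrt A‖ₑ ^ 2 * quadForm A x := by
  rw [quadForm_eq_sqrt hA, ← mul_pow]
  gcongr
  conv_lhs => rw [← sqrt_comp_sqrt hA]
  exact ContinuousLinearMap.le_opENorm _ _

/-- A positive operator of finite trace is Hilbert–Schmidt. Its compressions to finitely many output
coordinates converge to it in operator norm, the squared error being at most a tail of `∑ ‖A (b
i)‖²`. -/
lemma isCompactOperator_of_posTrace_lt_top {A : H →L[ℂ] H} (hA : A.IsPositive)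
    (h : posTrace A < ⊤) : IsCompactOperator A := by
  classical
  obtain ⟨w, b, hb⟩ := exists_hilbertBasis ℂ H
  have hsum : ∑' i, ‖A (b i)‖ₑ ^ 2 ≠ ⊤ := by
    refine ne_top_of_le_ne_top ?_ (ENNReal.tsum_le_tsum fun i => enorm_apply_sq_le hA (b i))
    rw [ENNReal.tsum_mul_left, ← posTrace_eq_tsum hA b]
    exact ENNReal.mul_ne_top (by simp) h.ne
  have htail := ENNReal.tendsto_tsum_compl_atTop_zero hsum
  have hbound : ∀ F : Finset w, ‖diagOp b F 1 ∘L A - A‖ₑ ^ 2 ≤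
      ∑' i : { i // i ∉ F }, ‖A (b i)‖ₑ ^ 2 := by
    intro F
    set s := ∑' i : { i // i ∉ F }, ‖A (b i)‖ₑ ^ 2 with hs
    have hs' : s ≠ ⊤ := by
      refine ne_top_of_le_ne_top hsum ?_
      exact ENNReal.tsum_comp_le_tsum_of_injective Subtype.val_injective (fun i => ‖A (b i)‖ₑ ^ 2)
    have key : ∀ x, ‖(diagOp b F 1 ∘L A - A) x‖ₑ ^ 2 ≤ s * ‖x‖ₑ ^ 2 := by
      intro x
      rw [← tsum_enorm_inner_sq b, hs, ← ENNReal.tsum_mul_right]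
      have h0 : ∀ i, ‖⟪b i, (diagOp b F 1 ∘L A - A) x⟫_ℂ‖ₑ ^ 2 =
          Set.indicator {i | i ∉ F} (fun i => ‖⟪b i, A x⟫_ℂ‖ₑ ^ 2) i := by
        intro i
        rw [sub_apply, ContinuousLinearMap.comp_apply, inner_sub_right, inner_diagOp]
        by_cases hi : i ∈ F <;> simp [hi]
      simp_rw [h0]
      rw [← tsum_subtype]
      refine ENNReal.tsum_le_tsum fun i => ?_
      rw [← mul_pow, ← ContinuousLinearMap.adjoint_inner_left, hA.isSelfAdjoint.adjoint_eq]
      gcongr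
      rw [← ofReal_norm, ← ofReal_norm, ← ofReal_norm, ← ENNReal.ofReal_mul (norm_nonneg _)]
      exact ENNReal.ofReal_le_ofReal (norm_inner_le_norm _ _)
    have : ‖diagOp b F 1 ∘L A - A‖ ≤ √(s.toReal) := by
      refine ContinuousLinearMap.opNorm_le_bound _ (Real.sqrt_nonneg _) fun x => ?_
      have h1 := key x
      rw [← ENNReal.ofReal_toReal hs', enorm_sq_eq_ofReal, enorm_sq_eq_ofReal,
        ← ENNReal.ofReal_mul ENNReal.toReal_nonneg, ENNReal.ofReal_le_ofReal_iff (by positivity)]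
        at h1
      rw [← Real.sqrt_sq (norm_nonneg x), ← Real.sqrt_mul ENNReal.toReal_nonneg]
      exact Real.le_sqrt_of_sq_le h1
    rw [enorm_sq_eq_ofReal, ENNReal.ofReal_le_iff_le_toReal hs']
    calc _ ≤ √(s.toReal) ^ 2 := by gcongr
      _ = s.toReal := Real.sq_sqrt ENNReal.toReal_nonneg
  have hlim : Tendsto (fun F : Finset w => diagOp b F 1 ∘L A) atTop (𝓝 A) := by
    rw [tendsto_iff_edist_tendsto_0]
    have h1 : Tendsto (fun F : Finset w => ‖diagOp b F 1 ∘L A - A‖ₑ ^ 2) atTop (𝓝 0) :=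
      tendsto_of_tendsto_of_tendsto_of_le_of_le tendsto_const_nhds htail (fun _ => zero_le)
        hbound
    have h2 := (ENNReal.continuous_rpow_const (y := (2⁻¹ : ℝ))).tendsto 0 |>.comp h1
    simp only [Function.comp_def, ENNReal.zero_rpow_of_pos (by norm_num : (0:ℝ) < 2⁻¹)] at h2
    convert h2 using 2 with F
    rw [← ENNReal.rpow_natCast, ← ENNReal.rpow_mul, edist_eq_enorm_sub]
    norm_num
  exact isCompactOperator_of_tendsto hlim
    (Eventually.of_forall fun F => (isCompactOperator_diagOp b F 1).comp_clm A)

/-- `b` is an orthonormal basis of eigenvectors of `A` with eigenvalues `l`. -/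
def IsEigenbasis {ι : Type*} (A : H →L[ℂ] H) (b : HilbertBasis ι ℂ H) (l : ι → ℝ≥0) : Prop :=
  ∀ i, A (b i) = ((l i : ℝ) : ℂ) • b i

/-- By compactness the eigenspaces have dense span. Hilbert bases of the separate eigenspaces,
kernel included, are glued together, and positivity makes the eigenvalues nonnegative reals. -/
theorem exists_isEigenbasis {H : Type u} [NormedAddCommGroup H] [InnerProductSpace ℂ H]
    [CompleteSpace H] {A : H →L[ℂ] H} (hA : A.IsPositive) (h : posTrace A < ⊤) :
    ∃ (ι : Type u) (b : HilbertBasis ι ℂ H) (l : ι → ℝ≥0), IsEigenbasis A b l := by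
  have hcomp := isCompactOperator_of_posTrace_lt_top hA h
  have hsymm : (A : H →ₗ[ℂ] H).IsSymmetric := hA.isSymmetric
  have hbot := ContinuousLinearMap.orthogonalComplement_iSup_eigenspaces_eq_bot hcomp hsymm
  have hcl : ∀ μ : ℂ, IsClosed ((Module.End.eigenspace (A : H →ₗ[ℂ] H) μ : Submodule ℂ H) : Set H) := by
    intro μ
    have : ((Module.End.eigenspace (A : H →ₗ[ℂ] H) μ : Submodule ℂ H) : Set H) =
        {x | A x = μ • x} := by
      ext x
      simp
    rw [this]
    exact isClosed_eq A.continuous (continuous_const_smul μ)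
  have hcs : ∀ μ : ℂ, CompleteSpace (Module.End.eigenspace (A : H →ₗ[ℂ] H) μ) :=
    fun μ => (hcl μ).completeSpace_coe
  choose w c hc using fun μ : ℂ => exists_hilbertBasis ℂ (Module.End.eigenspace (A : H →ₗ[ℂ] H) μ)
  have hortho : Orthonormal ℂ fun a : Σ μ : ℂ, w μ => ((c a.1 a.2 :
      Module.End.eigenspace (A : H →ₗ[ℂ] H) a.1) : H) :=
    hsymm.orthogonalFamily_eigenspaces.orthonormal_sigma_orthonormal (fun μ => (c μ).orthonormal)
  have hspan : (Submodule.span ℂ (Set.range fun a : Σ μ : ℂ, w μ => ((c a.1 a.2 :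
      Module.End.eigenspace (A : H →ₗ[ℂ] H) a.1) : H)))ᗮ = ⊥ := by
    rw [eq_bot_iff, ← hbot]
    intro x hx
    rw [Submodule.mem_orthogonal] at hx ⊢
    intro u hu
    induction hu using Submodule.iSup_induction' with
    | mem μ y hy =>
      have h1 := (c μ).hasSum_inner_mul_inner ⟨y, hy⟩
      have h2 : HasSum (fun i => ((c μ).repr ⟨y, hy⟩ i • (c μ i : H))) y :=
        ((c μ).hasSum_repr ⟨y, hy⟩).mapL (Submodule.subtypeL _)
      have h3 := h2.mapL (innerSL ℂ x)
      have h4 : ∀ i, innerSL ℂ x ((c μ).repr ⟨y, hy⟩ i • (c μ i : H)) = 0 := by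
        intro i
        have h5 := hx _ (Submodule.subset_span ⟨⟨μ, i⟩, rfl⟩)
        simp only at h5
        rw [map_smul, innerSL_apply_apply, inner_eq_zero_symm.1 h5, smul_zero]
      simp_rw [h4] at h3
      exact inner_eq_zero_symm.1 (h3.unique hasSum_zero)
    | zero => simp
    | add y z _ _ hy hz => rw [inner_add_left, hy, hz, add_zero]
  set b := HilbertBasis.mkOfOrthogonalEqBot hortho hspan with hb
  have hbv : ∀ a : Σ μ : ℂ, w μ, A (b a) = a.1 • b a := by
    intro a
    rw [hb, HilbertBasis.coe_mkOfOrthogonalEqBot]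
    exact Module.End.mem_eigenspace_iff.1 (c a.1 a.2).2
  refine ⟨_, b, fun a => ⟨a.1.re, ?_⟩, fun a => ?_⟩
  all_goals
    have h1 := hA.inner_nonneg_right (b a)
    rw [hbv, inner_smul_right, inner_self_eq_norm_sq_to_K, b.orthonormal.1 a] at h1
    have h2 : (0 : ℂ) ≤ a.1 := by simpa using h1
    rw [Complex.le_def] at h2
  · exact h2.1
  · rw [hbv]
    congr 1
    exact Complex.ext rfl (by simpa using h2.2.symm)

/-- The eigenvalue is a spectral point. The functions `g` that act on `x` as multiplication by `g r`
contain the constants and the identity, and are closed under sums, products and uniform limits. -/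
lemma cfc_apply_eigenvector {A : H →L[ℂ] H} (hA : IsSelfAdjoint A) {f : ℝ → ℝ}
    (hf : Continuous f) {x : H} (hx0 : x ≠ 0) {r : ℝ} (hx : A x = (r : ℂ) • x) :
    cfc f A x = ((f r : ℝ) : ℂ) • x := by
  have hr : r ∈ spectrum ℝ A := by
    rw [spectrum.mem_iff]
    rintro ⟨u, hu⟩
    apply hx0
    have h1 : (algebraMap ℝ (H →L[ℂ] H) r - A) x = 0 := by
      rw [sub_apply, hx, Algebra.algebraMap_eq_smul_one]
      simp
    rw [← hu] at h1
    calc x = ((u⁻¹ : (H →L[ℂ] H)ˣ) * (u : H →L[ℂ] H)) x := by simp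
      _ = (u⁻¹ : (H →L[ℂ] H)ˣ).1 ((u : H →L[ℂ] H) x) := rfl
      _ = 0 := by rw [h1, map_zero]
  rw [cfc_apply f A hA hf.continuousOn]
  suffices h : ∀ g : C(spectrum ℝ A, ℝ), cfcHom hA g x = ((g ⟨r, hr⟩ : ℝ) : ℂ) • x from h _
  intro g
  induction g using ContinuousMap.induction_on_of_compact with
  | const c =>
    have : cfcHom hA (ContinuousMap.const _ c) = algebraMap ℝ (H →L[ℂ] H) c :=
      AlgHomClass.commutes (cfcHom hA) c
    rw [this, Algebra.algebraMap_eq_smul_one]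
    simp
  | id => rw [cfcHom_id hA]; simpa using hx
  | star_id => rw [star_trivial, cfcHom_id hA]; simpa using hx
  | add f g hf hg => rw [map_add, add_apply, hf, hg]; simp [add_smul]
  | mul f g hf hg =>
    rw [map_mul, mul_apply_eq_comp, hg, map_smul, hf, smul_smul]
    simp [mul_comm]
  | frequently f hf =>
    have hcl : IsClosed {g : C(spectrum ℝ A, ℝ) |
        cfcHom hA g x = ((g ⟨r, hr⟩ : ℝ) : ℂ) • x} := by
      refine isClosed_eq ?_ ?_
      · exact (ContinuousLinearMap.apply ℂ H x).continuous.comp (cfcHom_continuous hA)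
      · exact (Complex.continuous_ofReal.comp (continuous_eval_const _)).smul
          continuous_const
    exact hcl.closure_subset (mem_closure_of_frequently_of_tendsto hf tendsto_id)

/-! ### The entropy in an eigenbasis -/

/-- The cost `-log q ∈ [0, ∞]` of a weight `q ≤ 1`. -/
def cost (q : ℝ≥0) : ℝ≥0∞ := if q = 0 then ⊤ else ENNReal.ofReal (-Real.log q)

/-- The homogeneous entropy of a positive operator of finite trace. -/
def ent (A : H →L[ℂ] H) : ℝ≥0∞ :=
  posTrace A * stateEntropy ((posTrace A).toReal⁻¹ • A)

lemma entropy_eq_ent (ρ : TraceClass H) : entropy ρ = ent (ρ : H →L[ℂ] H) := rfl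

lemma IsEigenbasis.quadForm {ι : Type*} {A : H →L[ℂ] H} {b : HilbertBasis ι ℂ H} {l : ι → ℝ≥0}
    (h : IsEigenbasis A b l) (i : ι) : EntropyLoss.quadForm A (b i) = l i := by
  rw [EntropyLoss.quadForm, h, inner_smul_right, inner_self_eq_norm_sq_to_K, b.orthonormal.1 i]
  simp

lemma IsEigenbasis.tsum {ι : Type*} {A : H →L[ℂ] H} {b : HilbertBasis ι ℂ H} {l : ι → ℝ≥0}
    (h : IsEigenbasis A b l) (hA : A.IsPositive) : ∑' i, (l i : ℝ≥0∞) = posTrace A := by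
  rw [posTrace_eq_tsum hA b]
  simp_rw [h.quadForm]

/-- After normalisation the spectrum lies in `[0, 1]`, where `-x log x ≥ 0`, so the trace may be
computed in `b`, on which the functional calculus is diagonal. Zero eigenvalues contribute `0 * ⊤ =
0`. -/
theorem IsEigenbasis.ent_eq {ι : Type*} {A : H →L[ℂ] H} {b : HilbertBasis ι ℂ H} {l : ι → ℝ≥0}
    (h : IsEigenbasis A b l) (hA : A.IsPositive) (htr : posTrace A < ⊤) :
    ent A = ∑' i, (l i : ℝ≥0∞) * cost (l i / (posTrace A).toNNReal) := by
  rcases eq_or_ne (posTrace A) 0 with h0 | h0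
  · have h1 := h.tsum hA
    rw [h0, ENNReal.tsum_eq_zero] at h1
    simp [ent, h0, h1]
  set t := (posTrace A).toNNReal with ht
  have hT : posTrace A = t := (ENNReal.coe_toNNReal htr.ne).symm
  have ht0 : t ≠ 0 := by rintro h1; rw [hT, h1] at h0; simp at h0
  have htpos : (0 : ℝ) < t := NNReal.coe_pos.2 (pos_iff_ne_zero.2 ht0)
  set T : H →L[ℂ] H := (posTrace A).toReal⁻¹ • A with hTdef
  have hTr : (posTrace A).toReal = t := rfl
  have hT' : T = (((t⁻¹ : ℝ≥0) : ℝ) : ℂ) • A := by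
    rw [hTdef, hTr, Complex.coe_smul, NNReal.coe_inv]
  have hTpos : T.IsPositive := by rw [hT']; exact isPositive_smul hA _
  have hnorm : ‖T‖ ≤ 1 := by
    have h1 := norm_le_traceNorm A
    rw [traceNorm_of_isPositive hA, hT, ← ofReal_norm, ENNReal.ofReal_le_iff_le_toReal (by simp)]
      at h1
    rw [hTdef, norm_smul, hTr, norm_inv, Real.norm_of_nonneg htpos.le, inv_mul_le_iff₀ htpos,
      mul_one]
    exact h1
  have hcfc : (cfc Real.negMulLog T).IsPositive := by
    rw [← ContinuousLinearMap.nonneg_iff_isPositive]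
    refine cfc_nonneg fun x hx => Real.negMulLog_nonneg ?_ ?_
    · exact spectrum_nonneg_of_nonneg ((ContinuousLinearMap.nonneg_iff_isPositive _).2 hTpos) hx
    · rcases subsingleton_or_nontrivial H with hs | hs
      · simp at hx
      exact (Real.le_norm_self x).trans ((spectrum.norm_le_norm_of_mem hx).trans hnorm)
  rw [ent, stateEntropy, posTrace_eq_tsum hcfc b, ← ENNReal.tsum_mul_left]
  refine tsum_congr fun i => ?_
  have hi : T (b i) = ((l i / t : ℝ) : ℂ) • b i := by
    rw [hT', smul_apply, h i, smul_smul]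
    congr 1
    push_cast
    ring
  rw [EntropyLoss.quadForm, cfc_apply_eigenvector hTpos.isSelfAdjoint Real.continuous_negMulLog
    (b.orthonormal.ne_zero i) hi, inner_smul_right, inner_self_eq_norm_sq_to_K,
    b.orthonormal.1 i]
  rcases eq_or_ne (l i) 0 with hl | hl
  · simp [hl]
  have hlpos : (0 : ℝ) < l i := NNReal.coe_pos.2 (pos_iff_ne_zero.2 hl)
  rw [cost, if_neg (div_ne_zero hl ht0), hT, ← ENNReal.ofReal_coe_nnreal,
    ← ENNReal.ofReal_coe_nnreal, ← ENNReal.ofReal_mul (NNReal.coe_nonneg _),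
    ← ENNReal.ofReal_mul (NNReal.coe_nonneg _)]
  congr 1
  simp only [Real.negMulLog]
  push_cast
  simp
  field_simp

/-! ### The variational bound for the entropy -/

lemma cost_mul_le (p q : ℝ≥0) : cost (p * q) ≤ cost p + cost q := by
  rcases eq_or_ne p 0 with hp | hp
  · simp [cost, hp]
  rcases eq_or_ne q 0 with hq | hq
  · simp [cost, hq]
  rw [cost, cost, cost, if_neg hp, if_neg hq, if_neg (mul_ne_zero hp hq), NNReal.coe_mul,
    Real.log_mul (by simpa using hp) (by simpa using hq), neg_add]
  exact ENNReal.ofReal_add_le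

lemma cost_ne_top {q : ℝ≥0} (hq : q ≠ 0) : cost q ≠ ⊤ := by
  rw [cost, if_neg hq]; exact ENNReal.ofReal_ne_top

/-- Gibbs' inequality for a single term. -/
lemma mul_cost_add_le {l t : ℝ≥0} (hlt : l ≤ t) (r : ℝ≥0) :
    (l : ℝ≥0∞) * cost (l / t) + l ≤ l * cost r + t * r := by
  rcases eq_or_ne l 0 with hl | hl
  · simp [hl]
  rcases eq_or_ne r 0 with hr | hr
  · simp [hr, cost, hl]
  have hlpos : (0 : ℝ) < l := NNReal.coe_pos.2 (pos_iff_ne_zero.2 hl)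
  have hrpos : (0 : ℝ) < r := NNReal.coe_pos.2 (pos_iff_ne_zero.2 hr)
  have ht : t ≠ 0 := by rintro rfl; exact hl (le_antisymm hlt (zero_le))
  have htpos : (0 : ℝ) < t := NNReal.coe_pos.2 (pos_iff_ne_zero.2 ht)
  have hlog : 0 ≤ -Real.log (l / t) := by
    rw [neg_nonneg]
    exact Real.log_nonpos (by positivity) ((div_le_one htpos).2 (by exact_mod_cast hlt))
  calc (l : ℝ≥0∞) * cost (l / t) + l
      = ENNReal.ofReal (l * (-Real.log (l / t)) + l) := by
        rw [cost, if_neg (div_ne_zero hl ht), ENNReal.ofReal_add (by positivity) (by positivity),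
          ENNReal.ofReal_mul hlpos.le, ENNReal.ofReal_coe_nnreal, NNReal.coe_div]
    _ ≤ ENNReal.ofReal (l * (-Real.log r) + t * r) := by
        refine ENNReal.ofReal_le_ofReal ?_
        -- `log x ≤ x - 1` at `x = r t / l`.
        have h1 := Real.log_le_sub_one_of_pos (show (0 : ℝ) < (r : ℝ) * t / l by positivity)
        rw [mul_div_assoc, Real.log_mul (by positivity) (by positivity)] at h1
        have h2 : Real.log (t / l : ℝ) = -Real.log (l / t) := by rw [← Real.log_inv, inv_div]
        rw [h2] at h1
        have h3 := mul_le_mul_of_nonneg_left h1 hlpos.le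
        have h4 : (l : ℝ) * (r * (t / l) - 1) = t * r - l := by field_simp
        rw [h4] at h3
        linarith
    _ ≤ l * cost r + t * r := by
        refine ENNReal.ofReal_add_le.trans ?_
        rw [cost, if_neg hr, ENNReal.ofReal_mul hlpos.le, ENNReal.ofReal_mul htpos.le]
        simp

lemma quadForm_diagOp {ι : Type*} (b : HilbertBasis ι ℂ H) (F : Finset ι) (c : ι → ℝ≥0) (x : H) :
    quadForm (diagOp b F c) x = ∑ i ∈ F, c i * ‖⟪b i, x⟫_ℂ‖ₑ ^ 2 := by
  rw [quadForm, diagOp_apply, inner_sum, map_sum, ENNReal.ofReal_sum_of_nonneg]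
  · refine Finset.sum_congr rfl fun i _ => ?_
    rw [inner_smul_right, inner_smul_right, ← inner_conj_symm x (b i), mul_comm ⟪b i, x⟫_ℂ,
      ← Complex.normSq_eq_conj_mul_self, enorm_sq_eq_ofReal, ← ENNReal.ofReal_coe_nnreal,
      ← ENNReal.ofReal_mul (NNReal.coe_nonneg _), Complex.normSq_eq_norm_sq]
    congr 1
    exact_mod_cast Complex.ofReal_re _
  · intro i _
    rw [inner_smul_right, inner_smul_right, ← inner_conj_symm x (b i), mul_comm ⟪b i, x⟫_ℂ,
      ← Complex.normSq_eq_conj_mul_self]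
    have : (0 : ℝ) ≤ c i * Complex.normSq ⟪b i, x⟫_ℂ :=
      mul_nonneg (NNReal.coe_nonneg _) (Complex.normSq_nonneg _)
    exact_mod_cast this

lemma quadForm_le_enorm_inner (A : H →L[ℂ] H) (x : H) : quadForm A x ≤ ‖⟪x, A x⟫_ℂ‖ₑ := by
  rw [quadForm, ← ofReal_norm]
  exact ENNReal.ofReal_le_ofReal (RCLike.re_le_norm _)

/-- In operator terms: `|v⟩⟨v| ≤ A` implies `⟨v, A⁻¹ v⟩ ≤ 1`. A finite truncation `D` of the inverse
satisfies `D A D = D`, so `q = ⟨v, D v⟩` obeys `q² ≤ ⟨D v, A D v⟩ = q`, and `q` is finite. -/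
lemma tsum_div_eigenvalue_le_one {ι : Type*} {A : H →L[ℂ] H} {b : HilbertBasis ι ℂ H}
    {l : ι → ℝ≥0} (h : IsEigenbasis A b l) (v : H)
    (hv : ∀ y, ‖⟪v, y⟫_ℂ‖ₑ ^ 2 ≤ quadForm A y) :
    ∑' j, ‖⟪v, b j⟫_ℂ‖ₑ ^ 2 / l j ≤ 1 := by
  classical
  have hzero : ∀ j, l j = 0 → ‖⟪v, b j⟫_ℂ‖ₑ ^ 2 = 0 := by
    intro j hj
    have := hv (b j)
    rw [h.quadForm, hj] at this
    simpa using this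
  rw [ENNReal.tsum_eq_iSup_sum]
  refine iSup_le fun J => ?_
  set D := diagOp b J (fun j => (l j)⁻¹) with hD
  have hDAD : ∀ x, D (A (D x)) = D x := by
    intro x
    conv_lhs => enter [2, 2]; rw [hD, diagOp_apply]
    rw [map_sum, map_sum]
    conv_rhs => rw [hD, diagOp_apply]
    refine Finset.sum_congr rfl fun j hj => ?_
    rw [map_smul, map_smul, map_smul, map_smul, h j, map_smul, hD, diagOp_basis, if_pos hj]
    rcases eq_or_ne (l j) 0 with h0 | h0
    · simp [h0]
    simp only [smul_smul]
    congr 1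
    have : ((l j : ℝ) : ℂ) ≠ 0 := by simpa using h0
    push_cast
    field_simp
  have hs : quadForm D v = ∑ j ∈ J, ‖⟪v, b j⟫_ℂ‖ₑ ^ 2 / l j := by
    rw [hD, quadForm_diagOp]
    refine Finset.sum_congr rfl fun j _ => ?_
    rcases eq_or_ne (l j) 0 with h0 | h0
    · simp [h0, hzero j h0]
    rw [ENNReal.coe_inv h0, mul_comm, ENNReal.div_eq_inv_mul, mul_comm, ← inner_conj_symm,
      enorm_sq_eq_ofReal, enorm_sq_eq_ofReal, RCLike.norm_conj]
  have hq : quadForm A (D v) = quadForm D v := by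
    rw [quadForm, quadForm]
    conv_rhs => rw [← hDAD, ← ContinuousLinearMap.adjoint_inner_left, hD, adjoint_diagOp]
  rw [← hs]
  have h1 : quadForm D v ^ 2 ≤ quadForm D v := by
    calc quadForm D v ^ 2 ≤ ‖⟪v, D v⟫_ℂ‖ₑ ^ 2 := by gcongr; exact quadForm_le_enorm_inner _ _
      _ ≤ quadForm D v := by rw [← hq]; exact hv _
  by_contra! hlt
  have h2 : quadForm D v * 1 < quadForm D v * quadForm D v :=
    ENNReal.mul_lt_mul_right (by rintro h0; rw [h0] at hlt; simp at hlt) (quadForm_ne_top _ _) hlt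
  rw [mul_one, ← sq] at h2
  exact absurd h1 (not_le.2 h2)

/-- The entropy is at most the cost of every decomposition into rank-one operators. -/
theorem ent_le_of_frame {A : H →L[ℂ] H} (hA : A.IsPositive) (htr : posTrace A < ⊤)
    {X : Type*} (v : X → H) (r : X → ℝ≥0)
    (hv : ∀ y, ∑' x, ‖⟪v x, y⟫_ℂ‖ₑ ^ 2 = quadForm A y) (hr : ∑' x, (r x : ℝ≥0∞) ≤ 1) :
    ent A ≤ ∑' x, ‖v x‖ₑ ^ 2 * cost (r x) := by
  obtain ⟨ι, b, l, h⟩ := exists_isEigenbasis hA htr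
  have hsum := h.tsum hA
  set t := (posTrace A).toNNReal with ht
  have hT : posTrace A = t := (ENNReal.coe_toNNReal htr.ne).symm
  have hlt : ∀ i, l i ≤ t := by
    intro i
    have := ENNReal.le_tsum (f := fun i => (l i : ℝ≥0∞)) i
    rw [hsum, hT] at this
    exact_mod_cast this
  set p : X → ι → ℝ≥0∞ := fun x j => ‖⟪v x, b j⟫_ℂ‖ₑ ^ 2 / l j with hp
  have hsingle : ∀ x y, ‖⟪v x, y⟫_ℂ‖ₑ ^ 2 ≤ quadForm A y := fun x y => by
    rw [← hv]; exact ENNReal.le_tsum (f := fun x => ‖⟪v x, y⟫_ℂ‖ₑ ^ 2) x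
  have hlp : ∀ x j, l j * p x j = ‖⟪v x, b j⟫_ℂ‖ₑ ^ 2 := by
    intro x j
    rcases eq_or_ne (l j) 0 with h0 | h0
    · have := hsingle x (b j)
      rw [h.quadForm, h0] at this
      simp only [hp, h0]
      simpa [eq_comm] using this
    · exact ENNReal.mul_div_cancel (by simpa using h0) (by simp)
  have hpx : ∀ j, l j ≠ 0 → ∑' x, p x j = 1 := by
    intro j hj
    simp_rw [hp, div_eq_mul_inv]
    rw [ENNReal.tsum_mul_right, hv, h.quadForm]
    exact ENNReal.mul_inv_cancel (by simpa using hj) (by simp)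
  have hpj : ∀ x, ∑' j, p x j ≤ 1 := fun x => tsum_div_eigenvalue_le_one h (v x) (hsingle x)
  have hlpj : ∀ x, ∑' j, p x j * l j = ‖v x‖ₑ ^ 2 := by
    intro x
    simp_rw [mul_comm (p x _), hlp]
    exact tsum_enorm_inner_sq' b (v x)
  -- Adding the trace supplies the summands `l j` of `mul_cost_add_le`; they are compensated on the
  -- right by `t * ∑ r ≤ t`, without any subtraction.
  refine ENNReal.le_of_add_le_add_right (a := (t : ℝ≥0∞)) (by simp) ?_
  calc ent A + t = ∑' j, ((l j : ℝ≥0∞) * cost (l j / t) + l j) := by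
        rw [ENNReal.tsum_add, ← h.ent_eq hA htr, hsum, hT]
    _ = ∑' j, ∑' x, p x j * ((l j : ℝ≥0∞) * cost (l j / t) + l j) := by
        refine tsum_congr fun j => ?_
        rw [ENNReal.tsum_mul_right]
        rcases eq_or_ne (l j) 0 with h0 | h0
        · simp [h0]
        · rw [hpx j h0, one_mul]
    _ = ∑' x, ∑' j, p x j * ((l j : ℝ≥0∞) * cost (l j / t) + l j) := ENNReal.tsum_comm
    _ ≤ ∑' x, ∑' j, p x j * (l j * cost (r x) + t * r x) := by
        refine ENNReal.tsum_le_tsum fun x => ENNReal.tsum_le_tsum fun j => ?_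
        exact mul_le_mul_right (mul_cost_add_le (hlt j) _) _
    _ = ∑' x, ((∑' j, p x j * l j) * cost (r x) + (∑' j, p x j) * (t * r x)) := by
        refine tsum_congr fun x => ?_
        simp_rw [mul_add, ← mul_assoc]
        rw [ENNReal.tsum_add, ENNReal.tsum_mul_right, ENNReal.tsum_mul_right,
          ENNReal.tsum_mul_right, mul_assoc]
    _ ≤ ∑' x, (‖v x‖ₑ ^ 2 * cost (r x) + 1 * (t * r x)) := by
        gcongr with x
        · rw [hlpj x]
        · exact hpj x
    _ ≤ ∑' x, ‖v x‖ₑ ^ 2 * cost (r x) + t := by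
        rw [ENNReal.tsum_add]
        gcongr
        simp_rw [one_mul]
        rw [ENNReal.tsum_mul_left]
        exact mul_le_of_le_one_right' hr

lemma tsum_enorm_inner_comp_sqrt {A : H →L[ℂ] H} (hA : A.IsPositive) {ι : Type*}
    (b : HilbertBasis ι ℂ H) (B : H →L[ℂ] K) (y : K) :
    ∑' i, ‖⟪B (CFC.sqrt A (b i)), y⟫_ℂ‖ₑ ^ 2 = quadForm A (adjoint B y) := by
  rw [quadForm_eq_sqrt hA, ← tsum_enorm_inner_sq b]
  refine tsum_congr fun i => ?_
  rw [← ContinuousLinearMap.adjoint_inner_right, ← ContinuousLinearMap.adjoint_inner_right,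
    adjoint_sqrt]

lemma tsum_enorm_inner_sqrt {A : H →L[ℂ] H} (hA : A.IsPositive) {ι : Type*}
    (b : HilbertBasis ι ℂ H) (y : H) :
    ∑' i, ‖⟪CFC.sqrt A (b i), y⟫_ℂ‖ₑ ^ 2 = quadForm A y := by
  have := tsum_enorm_inner_comp_sqrt hA b (ContinuousLinearMap.id ℂ H) y
  rwa [ContinuousLinearMap.adjoint_id] at this

lemma ent_le_of_basis {A : H →L[ℂ] H} (hA : A.IsPositive) (htr : posTrace A < ⊤)
    {ι : Type*} (b : HilbertBasis ι ℂ H) (r : ι → ℝ≥0) (hr : ∑' x, (r x : ℝ≥0∞) ≤ 1) :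
    ent A ≤ ∑' i, quadForm A (b i) * cost (r i) := by
  simp_rw [quadForm_eq_sqrt hA]
  exact ent_le_of_frame hA htr _ r (tsum_enorm_inner_sqrt hA b) hr

/-- The minimum is attained at the eigenbasis, with the normalised eigenvalues as weights. -/
lemma exists_ent_eq {H : Type u} [NormedAddCommGroup H] [InnerProductSpace ℂ H]
    [CompleteSpace H] {A : H →L[ℂ] H} (hA : A.IsPositive) (htr : posTrace A < ⊤) :
    ∃ (ι : Type u) (b : HilbertBasis ι ℂ H) (r : ι → ℝ≥0), ∑' x, (r x : ℝ≥0∞) ≤ 1 ∧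
      ent A = ∑' i, quadForm A (b i) * cost (r i) := by
  obtain ⟨ι, b, l, h⟩ := exists_isEigenbasis hA htr
  refine ⟨ι, b, fun i => l i / (posTrace A).toNNReal, ?_, ?_⟩
  · rcases eq_or_ne (posTrace A).toNNReal 0 with h0 | h0
    · simp [h0]
    simp_rw [ENNReal.coe_div h0, div_eq_mul_inv]
    rw [ENNReal.tsum_mul_right, h.tsum hA, ENNReal.coe_toNNReal htr.ne]
    exact ENNReal.mul_inv_le_one _
  · rw [h.ent_eq hA htr]
    simp_rw [h.quadForm]

/-! ### Consequences of the variational bound -/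

lemma ent_mono {A B : H →L[ℂ] H} (hA : A.IsPositive) (h : A ≤ B) (htr : posTrace B < ⊤) :
    ent A ≤ ent B := by
  obtain ⟨ι, b, r, hr, he⟩ := exists_ent_eq (isPositive_mono h hA) htr
  rw [he]
  refine (ent_le_of_basis hA ((posTrace_mono h).trans_lt htr) b r hr).trans ?_
  gcongr
  exact quadForm_mono h _

/-- Countable superadditivity of the entropy. -/
lemma tsum_ent_le {X : Type*} {τ : X → H →L[ℂ] H} {A : H →L[ℂ] H} (hτ : ∀ x, (τ x).IsPositive)
    (hA : A.IsPositive) (htr : posTrace A < ⊤)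
    (h : ∀ y, ∑' x, quadForm (τ x) y = quadForm A y) : ∑' x, ent (τ x) ≤ ent A := by
  obtain ⟨ι, b, r, hr, he⟩ := exists_ent_eq hA htr
  have hle : ∀ x, posTrace (τ x) < ⊤ := by
    intro x
    refine lt_of_le_of_lt ?_ htr
    rw [← posTrace_tsum h]
    exact ENNReal.le_tsum (f := fun x => posTrace (τ x)) x
  rw [he]
  simp_rw [← h, ← ENNReal.tsum_mul_right]
  rw [ENNReal.tsum_comm]
  exact ENNReal.tsum_le_tsum fun x => ent_le_of_basis (hτ x) (hle x) b r hr

lemma ent_add_ent_le {A B : H →L[ℂ] H} (hA : A.IsPositive) (hB : B.IsPositive)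
    (htr : posTrace (A + B) < ⊤) : ent A + ent B ≤ ent (A + B) := by
  have := tsum_ent_le (X := Bool) (τ := fun x => bif x then A else B) (A := A + B)
    (by rintro (_ | _) <;> simpa) (hA.add hB) htr
    (fun y => by rw [quadForm_add hA hB, tsum_bool]; simp [add_comm])
  rw [tsum_bool] at this
  simpa [add_comm] using this

lemma posTrace_ne_top_add {A B : H →L[ℂ] H} (hA : A.IsPositive) (hB : B.IsPositive)
    (h : posTrace A < ⊤) (h' : posTrace B < ⊤) : posTrace (A + B) < ⊤ := by
  rw [posTrace_add hA hB]; exact ENNReal.add_lt_top.2 ⟨h, h'⟩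

/-- The optimal families of `A` and `B` are put side by side, with weights scaled by `p` and `q`.
When `Tr B` is small, `p` can be taken near `1`, and the error is small. -/
lemma ent_add_le {A B : H →L[ℂ] H} (hA : A.IsPositive) (hB : B.IsPositive)
    (hAt : posTrace A < ⊤) (hBt : posTrace B < ⊤) {p q : ℝ≥0} (hpq : p + q ≤ 1) :
    ent (A + B) ≤ ent A + ent B + (posTrace A * cost p + posTrace B * cost q) := by
  obtain ⟨ι, b, r, hr, he⟩ := exists_ent_eq hA hAt
  obtain ⟨κ, c, s, hs, he'⟩ := exists_ent_eq hB hBt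
  have h1 := ent_le_of_frame (hA.add hB) (posTrace_ne_top_add hA hB hAt hBt)
    (Sum.elim (fun i => CFC.sqrt A (b i)) (fun j => CFC.sqrt B (c j)))
    (Sum.elim (fun i => p * r i) (fun j => q * s j)) ?_ ?_
  · refine h1.trans ?_
    rw [ENNReal.summable.tsum_sum ENNReal.summable]
    simp only [Sum.elim_inl, Sum.elim_inr, ← quadForm_eq_sqrt hA, ← quadForm_eq_sqrt hB]
    rw [he, he', posTrace_eq_tsum hA b, posTrace_eq_tsum hB c, ← ENNReal.tsum_mul_right,
      ← ENNReal.tsum_mul_right, add_add_add_comm, ← ENNReal.tsum_add, ← ENNReal.tsum_add]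
    gcongr with i j
    · rw [← mul_add, add_comm (cost _)]; gcongr; exact cost_mul_le _ _
    · rw [← mul_add, add_comm (cost _)]; gcongr; exact cost_mul_le _ _
  · intro y
    rw [ENNReal.summable.tsum_sum ENNReal.summable]
    simp only [Sum.elim_inl, Sum.elim_inr]
    rw [tsum_enorm_inner_sqrt hA, tsum_enorm_inner_sqrt hB, quadForm_add hA hB]
  · rw [ENNReal.summable.tsum_sum ENNReal.summable]
    simp only [Sum.elim_inl, Sum.elim_inr, ENNReal.coe_mul, ENNReal.tsum_mul_left]
    calc (p : ℝ≥0∞) * ∑' i, (r i : ℝ≥0∞) + q * ∑' i, (s i : ℝ≥0∞) ≤ p * 1 + q * 1 := by gcongr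
      _ ≤ 1 := by rw [mul_one, mul_one]; exact_mod_cast hpq

/-- If `b` is optimal for `B* B`, the vectors `B (b i)` decompose `B B*` with the same squared norms
and the same weights. -/
lemma ent_comp_adjoint_le {B : H →L[ℂ] K} (htr : posTrace (adjoint B ∘L B) < ⊤)
    (htr' : posTrace (B ∘L adjoint B) < ⊤) :
    ent (B ∘L adjoint B) ≤ ent (adjoint B ∘L B) := by
  obtain ⟨ι, b, r, hr, he⟩ := exists_ent_eq (ContinuousLinearMap.isPositive_adjoint_comp_self B) htr
  rw [he]
  simp_rw [quadForm_adjoint_comp]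
  refine ent_le_of_frame (ContinuousLinearMap.isPositive_self_comp_adjoint B) htr' _ r
    (fun y => ?_) hr
  have h2 := quadForm_adjoint_comp (adjoint B) y
  rw [ContinuousLinearMap.adjoint_adjoint] at h2
  rw [h2, ← tsum_enorm_inner_sq b]
  simp_rw [ContinuousLinearMap.adjoint_inner_right]

lemma ent_smul (c : ℝ≥0) (A : H →L[ℂ] H) : ent (((c : ℝ) : ℂ) • A) = c * ent A := by
  rcases eq_or_ne c 0 with hc | hc
  · simp [hc, ent]
  rw [ent, ent, posTrace_smul, mul_assoc]
  congr 3
  have : (c : ℝ) ≠ 0 := by simpa using hc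
  rw [ENNReal.toReal_mul, ENNReal.coe_toReal, Complex.coe_smul, smul_smul]
  congr 1
  field_simp

/-- Uniform weights `1 / k` on the eigenvectors with nonzero eigenvalue, of which there are at most
`k`. -/
lemma ent_le_of_rank {A : H →L[ℂ] H} (hA : A.IsPositive) (htr : posTrace A < ⊤) {k : ℕ}
    (hk : (A : H →ₗ[ℂ] H).rank ≤ (k : Cardinal)) :
    ent A ≤ posTrace A * cost (k : ℝ≥0)⁻¹ := by
  classical
  obtain ⟨ι, b, l, h⟩ := exists_isEigenbasis hA htr
  have hcard : ∀ F : Finset ι, (∀ i ∈ F, l i ≠ 0) → F.card ≤ k := by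
    intro F hF
    have hli : LinearIndependent ℂ (fun i : F => (⟨b i, ((l i : ℝ) : ℂ)⁻¹ • b i, by
        have : ((l i : ℝ) : ℂ) ≠ 0 := by simpa using hF i i.2
        rw [ContinuousLinearMap.coe_coe, map_smul, h i.1, smul_smul, inv_mul_cancel₀ this,
          one_smul]⟩ : LinearMap.range (A : H →ₗ[ℂ] H))) := by
      rw [← LinearMap.linearIndependent_iff (Submodule.subtype _) (Submodule.ker_subtype _)]
      exact b.orthonormal.linearIndependent.comp _ Subtype.val_injective
    have := hli.cardinal_lift_le_rank
    have h3 := (Cardinal.lift_le.2 hk)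
    have h4 := this.trans h3
    simpa using h4
  have hr : ∑' i, ((if l i = 0 then 0 else (k : ℝ≥0)⁻¹ : ℝ≥0) : ℝ≥0∞) ≤ 1 := by
    rw [ENNReal.tsum_eq_iSup_sum]
    refine iSup_le fun F => ?_
    have h1 : ∑ i ∈ F, (if l i = 0 then 0 else (k : ℝ≥0)⁻¹ : ℝ≥0) ≤ 1 := by
      rw [Finset.sum_ite, Finset.sum_const_zero, zero_add, Finset.sum_const, nsmul_eq_mul]
      have := hcard (F.filter fun i => ¬ l i = 0) (by simp)
      calc _ ≤ (k : ℝ≥0) * (k : ℝ≥0)⁻¹ := by gcongr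
        _ ≤ 1 := mul_inv_le_one
    exact_mod_cast h1
  refine (ent_le_of_basis hA htr b _ hr).trans ?_
  rw [posTrace_eq_tsum hA b, ← ENNReal.tsum_mul_right]
  refine ENNReal.tsum_le_tsum fun i => ?_
  rw [h.quadForm]
  split_ifs with h0
  · simp [h0]
  · exact le_rfl

lemma quadForm_sum {X : Type*} {τ : X → H →L[ℂ] H} (hτ : ∀ i, (τ i).IsPositive) (s : Finset X)
    (x : H) : quadForm (∑ i ∈ s, τ i) x = ∑ i ∈ s, quadForm (τ i) x := by
  classical
  induction s using Finset.induction_on with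
  | empty => simp
  | insert i s hi ih =>
    rw [Finset.sum_insert hi, Finset.sum_insert hi, quadForm_add (hτ i)
      (ContinuousLinearMap.isPositive_sum _ fun j _ => hτ j), ih]

/-! ### Maps with finitely many Kraus operators -/

/-- The action `A ↦ ∑ j, V j A (V j)*` of finitely many Kraus operators. -/
def krausMap {J : Type*} [Fintype J] (V : J → H →L[ℂ] K) (A : H →L[ℂ] H) : K →L[ℂ] K :=
  ∑ j, V j ∘L A ∘L adjoint (V j)

lemma isPositive_krausMap {J : Type*} [Fintype J] (V : J → H →L[ℂ] K) {A : H →L[ℂ] H}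
    (hA : A.IsPositive) : (krausMap V A).IsPositive :=
  ContinuousLinearMap.isPositive_sum _ fun j _ => hA.conj_adjoint (V j)

lemma quadForm_krausMap {J : Type*} [Fintype J] (V : J → H →L[ℂ] K) {A : H →L[ℂ] H}
    (hA : A.IsPositive) (y : K) :
    quadForm (krausMap V A) y = ∑ j, quadForm A (adjoint (V j) y) := by
  rw [krausMap, quadForm_sum fun j => hA.conj_adjoint (V j)]
  simp_rw [quadForm_conj]

/-- The trace of `V A V*` is the squared Hilbert–Schmidt norm of `V √A`. Computed in a basis of `H`,
it allows `hV` to be applied vector by vector. -/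
lemma posTrace_krausMap_le {J : Type*} [Fintype J] {V : J → H →L[ℂ] K}
    (hV : ∀ x, ∑ j, ‖V j x‖ₑ ^ 2 ≤ ‖x‖ₑ ^ 2) {A : H →L[ℂ] H} (hA : A.IsPositive) :
    posTrace (krausMap V A) ≤ posTrace A := by
  obtain ⟨w, g, -⟩ := exists_hilbertBasis ℂ H
  obtain ⟨w', c, -⟩ := exists_hilbertBasis ℂ K
  rw [posTrace_eq_tsum (isPositive_krausMap V hA) c, posTrace_eq_tsum hA g]
  simp_rw [quadForm_krausMap V hA]
  rw [Summable.tsum_finsetSum fun _ _ => ENNReal.summable]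
  have h1 : ∀ j, ∑' i, quadForm A (adjoint (V j) (c i)) = ∑' i, ‖V j (CFC.sqrt A (g i))‖ₑ ^ 2 := by
    intro j
    have h2 := tsum_enorm_sq_adjoint g c (V j ∘L CFC.sqrt A)
    rw [ContinuousLinearMap.adjoint_comp, adjoint_sqrt] at h2
    simp_rw [quadForm_eq_sqrt hA]
    exact h2.symm
  simp_rw [h1]
  rw [← Summable.tsum_finsetSum fun _ _ => ENNReal.summable]
  refine ENNReal.tsum_le_tsum fun i => ?_
  rw [quadForm_eq_sqrt hA]
  exact hV _

/-- Finitely many Kraus operators increase the entropy at most by the logarithm of their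
number. -/
lemma ent_krausMap_le {J : Type*} [Fintype J] {V : J → H →L[ℂ] K}
    (hV : ∀ x, ∑ j, ‖V j x‖ₑ ^ 2 ≤ ‖x‖ₑ ^ 2) {A : H →L[ℂ] H} (hA : A.IsPositive)
    (htr : posTrace A < ⊤) {w : ℝ≥0} (hw : Fintype.card J * w ≤ 1) :
    ent (krausMap V A) ≤ ent A + posTrace A * cost w := by
  obtain ⟨ι, b, r, hr, he⟩ := exists_ent_eq hA htr
  refine (ent_le_of_frame (X := J × ι) (isPositive_krausMap V hA)
    ((posTrace_krausMap_le hV hA).trans_lt htr) (fun x => V x.1 (CFC.sqrt A (b x.2)))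
    (fun x => w * r x.2) (fun y => ?_) ?_).trans ?_
  · rw [ENNReal.tsum_prod', tsum_fintype, quadForm_krausMap V hA]
    simp_rw [tsum_enorm_inner_comp_sqrt hA b]
  · rw [ENNReal.tsum_prod', tsum_fintype]
    simp_rw [ENNReal.coe_mul, ENNReal.tsum_mul_left]
    calc ∑ _j : J, (w : ℝ≥0∞) * ∑' i, (r i : ℝ≥0∞)
        ≤ ∑ _j : J, (w : ℝ≥0∞) * 1 := by gcongr
      _ ≤ 1 := by simpa using (by exact_mod_cast hw : (Fintype.card J : ℝ≥0∞) * w ≤ 1)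
  · rw [ENNReal.tsum_prod', ENNReal.tsum_comm, he, posTrace_eq_tsum hA b, ← ENNReal.tsum_mul_right,
      ← ENNReal.tsum_add]
    gcongr with i
    rw [tsum_fintype]
    dsimp only
    rw [← Finset.sum_mul, ← mul_add]
    gcongr
    · rw [quadForm_eq_sqrt hA]; exact hV _
    · rw [add_comm]; exact cost_mul_le _ _

/-! ### Decompositions into operators of bounded rank -/

/-- The family `τ` of positive operators of rank at most `k` has the (weak) sum `A`. -/
structure IsDecomposition {X : Type*} (k : ℕ) (τ : X → H →L[ℂ] H) (A : H →L[ℂ] H) : Prop where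
  isPositive : ∀ i, (τ i).IsPositive
  rank_le : ∀ i, ((τ i : H →L[ℂ] H) : H →ₗ[ℂ] H).rank ≤ (k : Cardinal)
  tsum_quadForm : ∀ x, ∑' i, quadForm (τ i) x = quadForm A x

/-- The `k`-approximator of the entropy, as a supremum over countable decompositions. -/
def appr (k : ℕ) (A : H →L[ℂ] H) : ℝ≥0∞ :=
  ⨆ (τ : ℕ → H →L[ℂ] H) (_ : IsDecomposition k τ A), ∑' i, ent (τ i)

lemma rank_smul_le (c : ℂ) (A : H →L[ℂ] H) :
    ((c • A : H →L[ℂ] H) : H →ₗ[ℂ] H).rank ≤ (A : H →ₗ[ℂ] H).rank := by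
  have : ((c • A : H →L[ℂ] H) : H →ₗ[ℂ] H) = (c • LinearMap.id) ∘ₗ (A : H →ₗ[ℂ] H) := by
    ext x; simp
  rw [this]
  exact LinearMap.rank_comp_le_right _ _

lemma posTrace_sum {X : Type*} {τ : X → H →L[ℂ] H} (hτ : ∀ i, (τ i).IsPositive) (s : Finset X) :
    posTrace (∑ i ∈ s, τ i) = ∑ i ∈ s, posTrace (τ i) := by
  classical
  induction s using Finset.induction_on with
  | empty => simp
  | insert i s hi ih =>
    rw [Finset.sum_insert hi, Finset.sum_insert hi, posTrace_add (hτ i)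
      (ContinuousLinearMap.isPositive_sum _ fun j _ => hτ j), ih]

lemma tendsto_of_traceTendsto {A : ℕ → TraceClass H} {A₀ : TraceClass H}
    (h : TraceTendsto A A₀) :
    Tendsto (fun n => (A n : H →L[ℂ] H)) atTop (𝓝 (A₀ : H →L[ℂ] H)) := by
  rw [tendsto_iff_edist_tendsto_0]
  refine tendsto_of_tendsto_of_tendsto_of_le_of_le tendsto_const_nhds h (fun _ => zero_le)
    fun n => ?_
  rw [edist_eq_enorm_sub]
  exact norm_le_traceNorm _

lemma continuous_quadForm (x : H) : Continuous fun A : H →L[ℂ] H => quadForm A x := by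
  refine ENNReal.continuous_ofReal.comp (RCLike.continuous_re.comp ?_)
  exact ((innerSL ℂ x).comp (ContinuousLinearMap.apply ℂ H x)).continuous

lemma isDecomposition_of_mem_ensembles {k : ℕ} {ρ : TraceClass H}
    {e : (ℕ → ℝ≥0) × (ℕ → TraceClass H)} (he : e ∈ ensembles k ρ) :
    IsDecomposition k (fun i => ((e.1 i : ℝ) : ℂ) • (e.2 i : H →L[ℂ] H)) (ρ : H →L[ℂ] H) := by
  obtain ⟨-, h2, h3⟩ := he
  have hpos : ∀ i, (((e.1 i : ℝ) : ℂ) • (e.2 i : H →L[ℂ] H)).IsPositive := fun i =>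
    isPositive_smul (h2 i).1 _
  refine ⟨hpos, fun i => (rank_smul_le _ _).trans (h2 i).2, fun x => ?_⟩
  have h4 := ((continuous_quadForm x).tendsto _).comp (tendsto_of_traceTendsto h3)
  have h5 := ENNReal.tendsto_nat_tsum
    (fun i => quadForm (((e.1 i : ℝ) : ℂ) • (e.2 i : H →L[ℂ] H)) x)
  refine tendsto_nhds_unique h5 ?_
  convert h4 using 2 with N
  rw [← quadForm_sum hpos]
  simp

lemma IsDecomposition.posTrace_lt_top {X : Type*} {k : ℕ} {τ : X → H →L[ℂ] H} {A : H →L[ℂ] H}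
    (h : IsDecomposition k τ A) (htr : posTrace A < ⊤) (i : X) : posTrace (τ i) < ⊤ := by
  refine lt_of_le_of_lt ?_ htr
  rw [← posTrace_tsum h.tsum_quadForm]
  exact ENNReal.le_tsum (f := fun x => posTrace (τ x)) i

/-- Any strictly positive probability weights turn a decomposition into an ensemble; `2^{-(i+1)}` is
used, with operators rescaled by the inverse weights. -/
lemma IsDecomposition.tsum_ent_le_approximator {k : ℕ} {τ : ℕ → H →L[ℂ] H} {ρ : TraceClass H}
    (hρ : ρ ∈ posCone H) (h : IsDecomposition k τ (ρ : H →L[ℂ] H)) :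
    ∑' i, ent (τ i) ≤ approximator k ρ := by
  have htr := posTrace_lt_top_of_mem ρ.2
  set A : H →L[ℂ] H := (ρ : H →L[ℂ] H) with hA
  have hApos : A.IsPositive := hρ
  let w : ℕ → ℝ≥0 := fun i => (2⁻¹ : ℝ≥0) ^ (i + 1)
  have hw0 : ∀ i, w i ≠ 0 := fun i => by positivity
  have hsum : HasSum w 1 := by
    rw [← NNReal.hasSum_coe]
    have := hasSum_geometric_two' 1
    rw [NNReal.coe_one]
    convert this using 2 with i
    simp only [w]
    push_cast
    rw [pow_succ, div_eq_mul_inv, inv_pow, mul_comm]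
    norm_num
  let σ : ℕ → TraceClass H := fun i =>
    ⟨((((w i)⁻¹ : ℝ≥0) : ℝ) : ℂ) • τ i, mem_traceClass (isPositive_smul (h.isPositive i) _) (by
      rw [posTrace_smul]
      exact ENNReal.mul_lt_top ENNReal.coe_lt_top (h.posTrace_lt_top htr i))⟩
  have hwσ : ∀ i, ((w i : ℝ) : ℂ) • (σ i : H →L[ℂ] H) = τ i := by
    intro i
    have : ((w i : ℝ) : ℂ) ≠ 0 := by simpa using hw0 i
    simp only [σ]
    rw [smul_smul, NNReal.coe_inv, Complex.ofReal_inv, mul_inv_cancel₀ this, one_smul]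
  have hmem : (w, σ) ∈ ensembles k ρ := by
    refine ⟨hsum, fun i => ⟨isPositive_smul (h.isPositive i) _,
      (rank_smul_le _ _).trans (h.rank_le i)⟩, ?_⟩
    have hS : ∀ N, ((∑ i ∈ Finset.range N, ((w i : ℝ) : ℂ) • σ i : TraceClass H) : H →L[ℂ] H) =
        ∑ i ∈ Finset.range N, τ i := by
      intro N
      rw [AddSubmonoidClass.coe_finsetSum]
      exact Finset.sum_congr rfl fun i _ => hwσ i
    have hSpos : ∀ N, (∑ i ∈ Finset.range N, τ i).IsPositive := fun N =>
      ContinuousLinearMap.isPositive_sum _ fun j _ => h.isPositive j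
    have hle : ∀ N, ∑ i ∈ Finset.range N, τ i ≤ A := by
      intro N
      refine le_of_quadForm_le (hSpos N) hApos fun x => ?_
      rw [quadForm_sum h.isPositive, ← h.tsum_quadForm]
      exact ENNReal.sum_le_tsum _
    -- The remainders are positive, so their trace norm is a difference of traces: weak summation
    -- already gives convergence in trace norm.
    have heq : ∀ N, traceNorm ((∑ i ∈ Finset.range N, τ i) - A) =
        posTrace A - ∑ i ∈ Finset.range N, posTrace (τ i) := by
      intro N
      have hp : (A - ∑ i ∈ Finset.range N, τ i).IsPositive :=
        (ContinuousLinearMap.le_def _ _).1 (hle N)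
      rw [← traceNorm_neg, neg_sub, traceNorm_of_isPositive hp]
      have h1 := posTrace_add hp (hSpos N)
      rw [sub_add_cancel, posTrace_sum h.isPositive] at h1
      rw [h1]
      refine (ENNReal.add_sub_cancel_right (ne_top_of_le_ne_top htr.ne ?_)).symm
      rw [h1]; exact le_add_self
    rw [TraceTendsto]
    simp_rw [hS]
    simp_rw [← hA, heq]
    have h1 := ENNReal.tendsto_nat_tsum (fun i => posTrace (τ i))
    rw [posTrace_tsum h.tsum_quadForm] at h1
    have h2 := ENNReal.Tendsto.sub (tendsto_const_nhds (x := posTrace A)) h1 (Or.inl htr.ne)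
    rwa [tsub_self] at h2
  refine le_trans ?_ (le_iSup₂ (f := fun (e : (ℕ → ℝ≥0) × (ℕ → TraceClass H))
    (_ : e ∈ ensembles k ρ) => ∑' i, (e.1 i : ℝ≥0∞) * entropy (e.2 i)) (w, σ) hmem)
  refine ENNReal.tsum_le_tsum fun i => ?_
  simp only
  rw [entropy_eq_ent, ← ent_smul, hwσ]

/-- By homogeneity of the entropy the probabilities of an ensemble can be absorbed into its
operators. -/
theorem approximator_eq_appr (k : ℕ) {ρ : TraceClass H} (hρ : ρ ∈ posCone H) :
    approximator k ρ = appr k (ρ : H →L[ℂ] H) := by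
  refine le_antisymm (iSup₂_le fun e he => ?_)
    (iSup₂_le fun τ h => h.tsum_ent_le_approximator hρ)
  refine le_trans ?_ (le_iSup₂ (f := fun (τ : ℕ → H →L[ℂ] H)
    (_ : IsDecomposition k τ (ρ : H →L[ℂ] H)) => ∑' i, ent (τ i)) _
    (isDecomposition_of_mem_ensembles he))
  refine ENNReal.tsum_le_tsum fun i => ?_
  rw [entropy_eq_ent, ent_smul]

lemma IsEigenbasis.tsum_quadForm {ι : Type*} {A : H →L[ℂ] H} {b : HilbertBasis ι ℂ H}
    {l : ι → ℝ≥0} (h : IsEigenbasis A b l) (hA : A.IsPositive) (x : H) :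
    ∑' i, (l i : ℝ≥0∞) * ‖⟪b i, x⟫_ℂ‖ₑ ^ 2 = EntropyLoss.quadForm A x := by
  have h1 := Complex.hasSum_re (b.hasSum_inner_mul_inner x (A x))
  have h2 : ∀ i, (⟪x, b i⟫_ℂ * ⟪b i, A x⟫_ℂ).re = l i * ‖⟪b i, x⟫_ℂ‖ ^ 2 := by
    intro i
    rw [← ContinuousLinearMap.adjoint_inner_left, hA.isSelfAdjoint.adjoint_eq, h i,
      inner_smul_left, ← inner_conj_symm x (b i), mul_left_comm, ← Complex.normSq_eq_conj_mul_self,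
      Complex.normSq_eq_norm_sq, Complex.conj_ofReal, ← Complex.ofReal_mul, Complex.ofReal_re]
  simp_rw [h2] at h1
  have h3 : RCLike.re ⟪x, A x⟫_ℂ = ∑' i, (l i : ℝ) * ‖⟪b i, x⟫_ℂ‖ ^ 2 := h1.tsum_eq.symm
  rw [EntropyLoss.quadForm, h3, ENNReal.ofReal_tsum_of_nonneg (fun i => by positivity)
    h1.summable]
  refine tsum_congr fun i => ?_
  rw [ENNReal.ofReal_mul (NNReal.coe_nonneg _), ENNReal.ofReal_coe_nnreal, enorm_sq_eq_ofReal]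

lemma rank_rankOne_le {k : ℕ} (hk : 1 ≤ k) (c : ℂ) (x : H) :
    ((c • InnerProductSpace.rankOne ℂ x x : H →L[ℂ] H) : H →ₗ[ℂ] H).rank ≤ (k : Cardinal) := by
  refine (rank_smul_le _ _).trans (le_trans ?_ (by exact_mod_cast hk : (1 : Cardinal) ≤ k))
  rw [LinearMap.rank, rank_submodule_le_one_iff']
  refine ⟨x, ?_⟩
  rintro _ ⟨y, rfl⟩
  exact Submodule.mem_span_singleton.2 ⟨⟪x, y⟫_ℂ, by simp⟩

/-- Sub-decompositions also bound the approximator from below. -/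
lemma tsum_ent_le_appr {k : ℕ} (hk : 1 ≤ k) {τ : ℕ → H →L[ℂ] H} {A B : H →L[ℂ] H}
    (h : IsDecomposition k τ B) (hB : B.IsPositive) (hBA : B ≤ A) (htr : posTrace A < ⊤) :
    ∑' i, ent (τ i) ≤ appr k A := by
  have hp : (A - B).IsPositive := (ContinuousLinearMap.le_def _ _).1 hBA
  have hptr : posTrace (A - B) < ⊤ := by
    refine lt_of_le_of_lt ?_ htr
    have := posTrace_add hp hB
    rw [sub_add_cancel] at this
    rw [this]; exact le_self_add
  -- The decomposition of `B` is completed by the rank-one spectral terms of `A - B`. Only countably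
  -- many eigenvalues are nonzero, so these terms and `τ` together can be indexed by `ℕ`.
  obtain ⟨ι, b, l, hb⟩ := exists_isEigenbasis hp hptr
  have hcount : (Function.support fun i => (l i : ℝ≥0∞)).Countable := by
    refine Summable.countable_support_ennreal ?_
    rw [hb.tsum hp]; exact hptr.ne
  set S := Function.support fun i => (l i : ℝ≥0∞) with hS
  have : Countable S := hcount.to_subtype
  obtain ⟨hd⟩ := nonempty_denumerable (ℕ ⊕ S)
  let e : ℕ ⊕ S ≃ ℕ := Denumerable.eqv (ℕ ⊕ S)
  let κ : ℕ ⊕ S → H →L[ℂ] H := Sum.elim τ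
    fun j => ((l j : ℝ) : ℂ) • InnerProductSpace.rankOne ℂ (b j) (b j)
  have hκpos : ∀ z, (κ z).IsPositive := by
    rintro (i | j)
    · exact h.isPositive i
    · exact isPositive_smul (InnerProductSpace.isPositive_rankOne_self (b j)) (l j)
  have hκ : IsDecomposition k (fun n => κ (e.symm n)) A := by
    refine ⟨fun n => hκpos _, fun n => ?_, fun x => ?_⟩
    · rcases e.symm n with (i | j)
      · exact h.rank_le i
      · exact rank_rankOne_le hk _ _
    · rw [e.symm.tsum_eq (fun z => quadForm (κ z) x), ENNReal.summable.tsum_sum ENNReal.summable]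
      have h1 : ∀ j : S, quadForm (κ (Sum.inr j)) x = (l j : ℝ≥0∞) * ‖⟪b j, x⟫_ℂ‖ₑ ^ 2 := by
        intro j
        simp only [κ, Sum.elim_inr]
        rw [← Finset.sum_singleton (fun j : ι => (l j : ℝ≥0∞) * ‖⟪b j, x⟫_ℂ‖ₑ ^ 2) (j : ι),
          ← quadForm_diagOp, diagOp, Finset.sum_singleton]
      simp_rw [h1]
      rw [tsum_subtype_eq_of_support_subset (f := fun j => (l j : ℝ≥0∞) * ‖⟪b j, x⟫_ℂ‖ₑ ^ 2),
        hb.tsum_quadForm hp]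
      · simp only [κ, Sum.elim_inl]
        rw [h.tsum_quadForm, ← quadForm_add hB hp, add_sub_cancel]
      · intro i hi
        rw [hS]
        rw [Function.mem_support] at hi ⊢
        exact left_ne_zero_of_mul hi
  calc ∑' i, ent (τ i) ≤ ∑' z, ent (κ z) := by
        rw [ENNReal.summable.tsum_sum ENNReal.summable]
        exact le_self_add
    _ = ∑' n, ent (κ (e.symm n)) := (e.symm.tsum_eq fun z => ent (κ z)).symm
    _ ≤ appr k A := le_iSup₂ (f := fun (τ : ℕ → H →L[ℂ] H)
        (_ : IsDecomposition k τ A) => ∑' i, ent (τ i)) _ hκ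

lemma appr_mono {k : ℕ} (hk : 1 ≤ k) {A B : H →L[ℂ] H} (hB : B.IsPositive) (hBA : B ≤ A)
    (htr : posTrace A < ⊤) : appr k B ≤ appr k A :=
  iSup₂_le fun _ h => tsum_ent_le_appr hk h hB hBA htr

lemma appr_le_posTrace (k : ℕ) {A : H →L[ℂ] H} (htr : posTrace A < ⊤) :
    appr k A ≤ posTrace A * cost (k : ℝ≥0)⁻¹ := by
  refine iSup₂_le fun τ h => ?_
  rw [← posTrace_tsum h.tsum_quadForm, ← ENNReal.tsum_mul_right]
  exact ENNReal.tsum_le_tsum fun i =>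
    ent_le_of_rank (h.isPositive i) (h.posTrace_lt_top htr i) (h.rank_le i)

lemma appr_lt_top {k : ℕ} (hk : 1 ≤ k) {A : H →L[ℂ] H} (htr : posTrace A < ⊤) : appr k A < ⊤ := by
  refine (appr_le_posTrace k htr).trans_lt (ENNReal.mul_lt_top htr ?_)
  rw [lt_top_iff_ne_top]
  refine cost_ne_top (inv_ne_zero ?_)
  exact_mod_cast (by omega : k ≠ 0)

lemma appr_le_ent (k : ℕ) {A : H →L[ℂ] H} (hA : A.IsPositive) (htr : posTrace A < ⊤) :
    appr k A ≤ ent A :=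
  iSup₂_le fun _ h => tsum_ent_le h.isPositive hA htr h.tsum_quadForm

lemma appr_mono_right {k k' : ℕ} (hk : k ≤ k') (A : H →L[ℂ] H) : appr k A ≤ appr k' A :=
  iSup₂_le fun τ h => le_iSup₂ (f := fun (τ : ℕ → H →L[ℂ] H)
    (_ : IsDecomposition k' τ A) => ∑' i, ent (τ i)) τ
    ⟨h.isPositive, fun i => (h.rank_le i).trans (by exact_mod_cast hk), h.tsum_quadForm⟩

@[simp] lemma ent_zero : ent (0 : H →L[ℂ] H) = 0 := by simp [ent]

lemma ent_le_appr {k : ℕ} (hk : 1 ≤ k) {A B : H →L[ℂ] H} (hB : B.IsPositive)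
    (hr : (B : H →ₗ[ℂ] H).rank ≤ (k : Cardinal)) (hBA : B ≤ A) (htr : posTrace A < ⊤) :
    ent B ≤ appr k A := by
  have h : IsDecomposition k (fun n : ℕ => if n = 0 then B else 0) B := by
    refine ⟨fun n => ?_, fun n => ?_, fun x => ?_⟩
    · split_ifs
      exacts [hB, ContinuousLinearMap.isPositive_zero]
    · split_ifs
      · exact hr
      · simp [LinearMap.rank_zero]
    · rw [tsum_eq_single 0 (fun n hn => by simp [hn])]
      simp
  have h1 := tsum_ent_le_appr hk h hB hBA htr
  rw [tsum_eq_single 0 (fun n hn => by simp [hn])] at h1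
  simpa using h1

/-! ### Spectral truncations -/

lemma rank_diagOp_le {ι : Type*} (b : HilbertBasis ι ℂ H) (F : Finset ι) (c : ι → ℝ≥0) :
    (diagOp b F c : H →ₗ[ℂ] H).rank ≤ (F.card : Cardinal) := by
  classical
  have h1 : LinearMap.range (diagOp b F c : H →ₗ[ℂ] H) ≤ Submodule.span ℂ (F.image b : Set H) := by
    rintro _ ⟨x, rfl⟩
    rw [ContinuousLinearMap.coe_coe, diagOp_apply]
    refine Submodule.sum_mem _ fun i hi => Submodule.smul_mem _ _ (Submodule.smul_mem _ _ ?_)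
    exact Submodule.subset_span (by simpa using ⟨i, hi, rfl⟩)
  refine (Submodule.rank_mono h1).trans ((rank_span_finset_le _).trans ?_)
  exact_mod_cast Finset.card_image_le

lemma isEigenbasis_diagOp {ι : Type*} [DecidableEq ι] (b : HilbertBasis ι ℂ H) (F : Finset ι)
    (c : ι → ℝ≥0) : IsEigenbasis (diagOp b F c) b (fun i => if i ∈ F then c i else 0) := by
  intro i
  rw [diagOp_basis]
  dsimp only
  split_ifs <;> simp

lemma posTrace_diagOp {ι : Type*} (b : HilbertBasis ι ℂ H) (F : Finset ι)
    (c : ι → ℝ≥0) : posTrace (diagOp b F c) = ∑ i ∈ F, (c i : ℝ≥0∞) := by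
  classical
  rw [← (isEigenbasis_diagOp b F c).tsum (isPositive_diagOp b F c),
    tsum_eq_sum (s := F) (fun i hi => by simp [hi])]
  exact Finset.sum_congr rfl fun i hi => by simp [hi]

lemma IsEigenbasis.diagOp_le {ι : Type*} {A : H →L[ℂ] H} {b : HilbertBasis ι ℂ H}
    {l : ι → ℝ≥0} (h : IsEigenbasis A b l) (hA : A.IsPositive) (F : Finset ι) :
    diagOp b F l ≤ A := by
  refine le_of_quadForm_le (isPositive_diagOp b F l) hA fun x => ?_
  rw [quadForm_diagOp, ← h.tsum_quadForm hA]
  exact ENNReal.sum_le_tsum _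

/-- The truncation is normalised by its own trace `s` instead of `t`. The change costs `s * cost (s
/ t)`, which is at most `t - s` by Gibbs' inequality with `r = 1`. -/
lemma IsEigenbasis.sum_le_ent_diagOp {ι : Type*} {A : H →L[ℂ] H} {b : HilbertBasis ι ℂ H}
    {l : ι → ℝ≥0} (h : IsEigenbasis A b l) (hA : A.IsPositive) (htr : posTrace A < ⊤)
    (F : Finset ι) :
    ∑ i ∈ F, (l i : ℝ≥0∞) * cost (l i / (posTrace A).toNNReal) ≤
      ent (diagOp b F l) + (posTrace A - ∑ i ∈ F, (l i : ℝ≥0∞)) := by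
  classical
  set t := (posTrace A).toNNReal with ht
  have hT : posTrace A = t := (ENNReal.coe_toNNReal htr.ne).symm
  set s := ∑ i ∈ F, l i with hs
  have hs' : ∑ i ∈ F, (l i : ℝ≥0∞) = s := by rw [hs]; push_cast; rfl
  have hst : s ≤ t := by
    rw [← ENNReal.coe_le_coe, ← hs', ← hT, ← h.tsum hA]
    exact ENNReal.sum_le_tsum _
  have hts : posTrace (diagOp b F l) = s := by rw [posTrace_diagOp, hs']
  have he : ent (diagOp b F l) = ∑ i ∈ F, (l i : ℝ≥0∞) * cost (l i / s) := by
    rw [(isEigenbasis_diagOp b F l).ent_eq (isPositive_diagOp b F l) (by rw [hts]; simp), hts,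
      ENNReal.toNNReal_coe, tsum_eq_sum (s := F) (fun i hi => by simp [hi])]
    exact Finset.sum_congr rfl fun i hi => by simp [hi]
  have hg : (s : ℝ≥0∞) * cost (s / t) ≤ t - s := by
    have := mul_cost_add_le hst 1
    refine ENNReal.le_sub_of_add_le_right (by simp) ?_
    simpa [cost] using this
  rw [hs', hT, he]
  refine le_trans ?_ (add_le_add_right hg _)
  rw [← hs', Finset.sum_mul, ← Finset.sum_add_distrib]
  refine Finset.sum_le_sum fun i hi => ?_
  rw [← mul_add]
  rcases eq_or_ne (l i) 0 with h0 | h0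
  · simp [h0]
  have hs0 : s ≠ 0 := by
    intro h1
    rw [hs, Finset.sum_eq_zero_iff] at h1
    exact h0 (h1 i hi)
  gcongr
  refine le_trans (le_of_eq ?_) (cost_mul_le _ _)
  congr 1
  field_simp

lemma IsEigenbasis.tendsto_posTrace_sub {ι : Type*} {A : H →L[ℂ] H} {b : HilbertBasis ι ℂ H}
    {l : ι → ℝ≥0} (h : IsEigenbasis A b l) (hA : A.IsPositive) (htr : posTrace A < ⊤) :
    Tendsto (fun F : Finset ι => posTrace A - ∑ i ∈ F, (l i : ℝ≥0∞)) atTop (𝓝 0) := by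
  have h1 : Tendsto (fun F : Finset ι => ∑ i ∈ F, (l i : ℝ≥0∞)) atTop (𝓝 (posTrace A)) := by
    rw [← h.tsum hA]; exact ENNReal.summable.hasSum
  have h2 := ENNReal.Tendsto.sub (tendsto_const_nhds (x := posTrace A)) h1 (Or.inl htr.ne)
  rwa [tsub_self] at h2

lemma IsEigenbasis.eventually_lt_ent_diagOp {ι : Type*} {A : H →L[ℂ] H} {b : HilbertBasis ι ℂ H}
    {l : ι → ℝ≥0} (h : IsEigenbasis A b l) (hA : A.IsPositive) (htr : posTrace A < ⊤)
    {a : ℝ≥0∞} (ha : a < ent A) {δ : ℝ≥0∞} (hδ : 0 < δ) :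
    ∀ᶠ F : Finset ι in atTop, a ≤ ent (diagOp b F l) + δ ∧
      posTrace A - ∑ i ∈ F, (l i : ℝ≥0∞) ≤ δ := by
  have h1 : Tendsto (fun F : Finset ι => ∑ i ∈ F, (l i : ℝ≥0∞) *
      cost (l i / (posTrace A).toNNReal)) atTop (𝓝 (ent A)) := by
    rw [h.ent_eq hA htr]; exact ENNReal.summable.hasSum
  filter_upwards [h1.eventually_const_lt ha,
    (h.tendsto_posTrace_sub hA htr).eventually_lt_const hδ] with F hF1 hF2
  exact ⟨hF1.le.trans ((h.sum_le_ent_diagOp hA htr F).trans (by gcongr)), hF2.le⟩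

/-- The approximators increase to the entropy. -/
theorem tendsto_appr {A : H →L[ℂ] H} (hA : A.IsPositive) (htr : posTrace A < ⊤) :
    Tendsto (fun k => appr k A) atTop (𝓝 (ent A)) := by
  have hmono : Monotone fun k => appr k A := fun k k' h => appr_mono_right h A
  have h1 := tendsto_atTop_iSup hmono
  suffices h : ⨆ k, appr k A = ent A by rwa [h] at h1
  refine le_antisymm (iSup_le fun k => appr_le_ent k hA htr) ?_
  obtain ⟨ι, b, l, h⟩ := exists_isEigenbasis hA htr
  refine le_of_forall_lt_imp_le_of_dense fun a ha => ?_
  refine ENNReal.le_of_forall_pos_le_add fun δ hδ _ => ?_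
  obtain ⟨F, hF⟩ := (h.eventually_lt_ent_diagOp hA htr ha (ENNReal.coe_pos.2 hδ)).exists
  refine hF.1.trans (add_le_add_left ?_ _)
  -- The added `1` keeps the order positive when `F` is empty.
  refine le_trans ?_ (le_iSup _ (F.card + 1))
  refine ent_le_appr (by omega) (isPositive_diagOp b F l) ((rank_diagOp_le b F l).trans ?_)
    (h.diagOp_le hA F) htr
  exact_mod_cast Nat.le_succ _

/-! ### Continuity of the approximators -/

lemma IsEigenbasis.sqrt_apply {ι : Type*} {A : H →L[ℂ] H} {b : HilbertBasis ι ℂ H}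
    {l : ι → ℝ≥0} (h : IsEigenbasis A b l) (hA : A.IsPositive) (i : ι) :
    CFC.sqrt A (b i) = ((NNReal.sqrt (l i) : ℝ) : ℂ) • b i := by
  rw [CFC.sqrt_eq_real_sqrt A ((ContinuousLinearMap.nonneg_iff_isPositive _).2 hA),
    cfcₙ_eq_cfc (hf0 := Real.sqrt_zero),
    cfc_apply_eigenvector hA.isSelfAdjoint Real.continuous_sqrt (b.orthonormal.ne_zero i) (h i),
    Real.coe_sqrt]

/-- A Powers-Størmer inequality for ordered operators. -/
lemma tsum_enorm_sqrt_sub_sqrt_sq_add_le {A B : H →L[ℂ] H} (hA : A.IsPositive) (hAB : A ≤ B)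
    (htr : posTrace B < ⊤) {ι : Type*} (g : HilbertBasis ι ℂ H) :
    ∑' i, ‖(CFC.sqrt B - CFC.sqrt A) (g i)‖ₑ ^ 2 + posTrace A ≤ posTrace B := by
  have hB := isPositive_mono hAB hA
  obtain ⟨κ, b, l, h⟩ := exists_isEigenbasis hA ((posTrace_mono hAB).trans_lt htr)
  rw [tsum_enorm_sq_adjoint g b, map_sub, adjoint_sqrt, adjoint_sqrt, posTrace_eq_tsum hA b,
    posTrace_eq_tsum hB b, ← ENNReal.tsum_add]
  refine ENNReal.tsum_le_tsum fun i => ?_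
  -- At a unit eigenvector `b` of `A` with eigenvalue `l`, the squared norm is `⟨b, B b⟩ - 2 √l ⟨b,
  -- √B b⟩ + l`; operator monotonicity of the square root gives `⟨b, √B b⟩ ≥ √l`.
  have hmono : CFC.sqrt A ≤ CFC.sqrt B := CFC.sqrt_le_sqrt A B hAB
  have h1 := quadForm_mono hmono (b i)
  rw [quadForm, quadForm, ENNReal.ofReal_le_ofReal_iff
    ((isPositive_sqrt B).re_inner_nonneg_right _), h.sqrt_apply hA, inner_smul_right,
    inner_self_eq_norm_sq_to_K, b.orthonormal.1 i] at h1
  rw [h.quadForm, quadForm_eq_sqrt hB, sub_apply, h.sqrt_apply hA, enorm_sq_eq_ofReal,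
    enorm_sq_eq_ofReal, ← ENNReal.ofReal_coe_nnreal, ← ENNReal.ofReal_add (by positivity)
    (NNReal.coe_nonneg _)]
  refine ENNReal.ofReal_le_ofReal ?_
  rw [@norm_sub_sq ℂ, inner_smul_right, norm_smul, b.orthonormal.1 i]
  have h2 : RCLike.re (((NNReal.sqrt (l i) : ℝ) : ℂ) * ⟪CFC.sqrt B (b i), b i⟫_ℂ) =
      NNReal.sqrt (l i) * RCLike.re ⟪b i, CFC.sqrt B (b i)⟫_ℂ := by
    rw [inner_re_symm (𝕜 := ℂ) (b i)]
    simp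
  rw [h2]
  have h3 : (NNReal.sqrt (l i) : ℝ) * NNReal.sqrt (l i) = l i := by
    exact_mod_cast NNReal.mul_self_sqrt (l i)
  have h4 : (NNReal.sqrt (l i) : ℝ) ≤ RCLike.re ⟪b i, CFC.sqrt B (b i)⟫_ℂ := by simpa using h1
  have h5 := mul_le_mul_of_nonneg_left h4 (NNReal.coe_nonneg (NNReal.sqrt (l i)))
  have h6 : ‖((NNReal.sqrt (l i) : ℝ) : ℂ)‖ = NNReal.sqrt (l i) := by simp
  rw [h6, mul_one, sq (NNReal.sqrt (l i) : ℝ), h3]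
  linarith

lemma posTrace_conj_eq {A : H →L[ℂ] H} (hA : A.IsPositive) (B : H →L[ℂ] H) {ι : Type*}
    (g : HilbertBasis ι ℂ H) :
    posTrace (B ∘L A ∘L adjoint B) = ∑' i, ‖B (CFC.sqrt A (g i))‖ₑ ^ 2 := by
  have h1 : B ∘L A ∘L adjoint B = (B ∘L CFC.sqrt A) ∘L adjoint (B ∘L CFC.sqrt A) := by
    rw [ContinuousLinearMap.adjoint_comp, adjoint_sqrt]
    conv_lhs => rw [← sqrt_comp_sqrt hA]
    rfl
  rw [h1, ← posTrace_comm g g, posTrace_eq_tsum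
    (ContinuousLinearMap.isPositive_adjoint_comp_self _) g]
  simp_rw [quadForm_adjoint_comp]
  rfl

/-- `T` is `√A B^{-1/2}`, with the inverse root truncated to finitely many eigenvectors `J` of `B`.
Then `T B T* ≤ A`. On the retained eigenvectors `(1 - T) √B` is no larger than `√B - √A`, which the
Powers–Størmer bound controls; the others contribute a tail of eigenvalues below `δ`. -/
lemma exists_transport {A B : H →L[ℂ] H} (hA : A.IsPositive) (hAB : A ≤ B)
    (htr : posTrace B < ⊤) {δ : ℝ≥0∞} (hδ : 0 < δ) :
    ∃ T : H →L[ℂ] H, T ∘L B ∘L adjoint T ≤ A ∧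
      posTrace ((1 - T) ∘L B ∘L adjoint (1 - T)) + posTrace A ≤ posTrace B + δ := by
  classical
  have hB := isPositive_mono hAB hA
  obtain ⟨ι, g, l, h⟩ := exists_isEigenbasis hB htr
  obtain ⟨J, hJ⟩ := ((ENNReal.tendsto_tsum_compl_atTop_zero
    (show ∑' i, (l i : ℝ≥0∞) ≠ ⊤ by rw [h.tsum hB]; exact htr.ne)).eventually_lt_const hδ).exists
  set D := diagOp g J (fun j => (NNReal.sqrt (l j))⁻¹) with hD
  refine ⟨CFC.sqrt A ∘L D, ?_, ?_⟩
  · refine le_of_quadForm_le (hB.conj_adjoint _) hA fun y => ?_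
    rw [quadForm_conj, ContinuousLinearMap.adjoint_comp, adjoint_sqrt, hD, adjoint_diagOp,
      ContinuousLinearMap.comp_apply, ← h.tsum_quadForm hB, quadForm_eq_sqrt hA y,
      ← tsum_enorm_inner_sq g]
    refine ENNReal.tsum_le_tsum fun i => ?_
    rw [inner_diagOp]
    split_ifs
    · rw [enorm_mul, mul_pow, ← mul_assoc]
      refine mul_le_of_le_one_left' ?_
      have h1 : ‖(((NNReal.sqrt (l i))⁻¹ : ℝ≥0) : ℝ)‖ₑ = ((NNReal.sqrt (l i))⁻¹ : ℝ≥0) := by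
        rw [Real.enorm_of_nonneg (NNReal.coe_nonneg _), ENNReal.ofReal_coe_nnreal]
      have h2 : ‖((((NNReal.sqrt (l i))⁻¹ : ℝ≥0) : ℝ) : ℂ)‖ₑ = ((NNReal.sqrt (l i))⁻¹ : ℝ≥0) := by
        rw [← h1, ← ofReal_norm, ← ofReal_norm, Complex.norm_real]
      rw [h2]
      have h3 : l i * (NNReal.sqrt (l i))⁻¹ ^ 2 ≤ 1 := by
        rw [inv_pow, NNReal.sq_sqrt]
        exact mul_inv_le_one
      exact_mod_cast h3
    · simp
  · rw [posTrace_conj_eq hB _ g]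
    have hle : ∀ i, ‖(1 - CFC.sqrt A ∘L D) (CFC.sqrt B (g i))‖ₑ ^ 2 ≤
        ‖(CFC.sqrt B - CFC.sqrt A) (g i)‖ₑ ^ 2 +
          Set.indicator {i | i ∉ J} (fun i => (l i : ℝ≥0∞)) i := by
      intro i
      rw [sub_apply, ContinuousLinearMap.comp_apply, h.sqrt_apply hB, map_smul, map_smul, hD,
        diagOp_basis, sub_apply, h.sqrt_apply hB]
      by_cases hi : i ∈ J
      · refine le_add_of_le_of_nonneg ?_ zero_le
        rw [if_pos hi]
        rcases eq_or_ne (l i) 0 with h0 | h0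
        · simp [h0]
        · have h2 : ((NNReal.sqrt (l i) : ℝ) : ℂ) ≠ 0 := by simpa using h0
          rw [smul_smul, NNReal.coe_inv, Complex.ofReal_inv, mul_inv_cancel₀ h2, one_smul]
          exact le_rfl
      · refine le_add_of_nonneg_of_le zero_le ?_
        rw [if_neg hi, Set.indicator_of_mem (by exact hi)]
        have h1 : ‖((NNReal.sqrt (l i) : ℝ) : ℂ) • g i‖ₑ ^ 2 = l i := by
          rw [enorm_sq_eq_ofReal, norm_smul, g.orthonormal.1 i, Complex.norm_real,
            mul_one, Real.norm_of_nonneg (NNReal.coe_nonneg _)]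
          norm_cast
          rw [NNReal.sq_sqrt, ENNReal.ofReal_coe_nnreal]
        simpa using h1.le
    calc _ ≤ (∑' i, ‖(CFC.sqrt B - CFC.sqrt A) (g i)‖ₑ ^ 2 +
          ∑' i, Set.indicator {i | i ∉ J} (fun i => (l i : ℝ≥0∞)) i) + posTrace A := by
          rw [← ENNReal.tsum_add]
          gcongr with i
          exact hle i
      _ = (∑' i, ‖(CFC.sqrt B - CFC.sqrt A) (g i)‖ₑ ^ 2 + posTrace A) +
          ∑' i : {i // i ∉ J}, (l i : ℝ≥0∞) := by
          rw [← tsum_subtype, add_right_comm]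
          rfl
      _ ≤ _ := by
          gcongr
          exact tsum_enorm_sqrt_sub_sqrt_sq_add_le hA hAB htr g

lemma rank_conj_le (A B C : H →L[ℂ] H) :
    ((B ∘L A ∘L C : H →L[ℂ] H) : H →ₗ[ℂ] H).rank ≤ (A : H →ₗ[ℂ] H).rank := by
  have : ((B ∘L A ∘L C : H →L[ℂ] H) : H →ₗ[ℂ] H) =
      (B : H →ₗ[ℂ] H) ∘ₗ ((A : H →ₗ[ℂ] H) ∘ₗ (C : H →ₗ[ℂ] H)) := rfl
  rw [this]
  exact (LinearMap.rank_comp_le_right _ _).trans (LinearMap.rank_comp_le_left _ _)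

lemma enorm_add_sq_le {E : Type*} [NormedAddCommGroup E] {s : ℝ≥0} (hs : 0 < s) (x y : E) :
    ‖x + y‖ₑ ^ 2 ≤ ((1 + s : ℝ≥0) : ℝ≥0∞) * ‖x‖ₑ ^ 2 + ((1 + s⁻¹ : ℝ≥0) : ℝ≥0∞) * ‖y‖ₑ ^ 2 := by
  have hs' : (0 : ℝ) < s := hs
  rw [enorm_sq_eq_ofReal, enorm_sq_eq_ofReal, enorm_sq_eq_ofReal, ← ENNReal.ofReal_coe_nnreal,
    ← ENNReal.ofReal_coe_nnreal, ← ENNReal.ofReal_mul (NNReal.coe_nonneg _),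
    ← ENNReal.ofReal_mul (NNReal.coe_nonneg _),
    ← ENNReal.ofReal_add (by positivity) (by positivity)]
  refine ENNReal.ofReal_le_ofReal ?_
  push_cast
  have h1 : ‖x + y‖ ^ 2 ≤ (‖x‖ + ‖y‖) ^ 2 := by gcongr; exact norm_add_le x y
  have h2 : 2 * ‖x‖ * ‖y‖ ≤ s * ‖x‖ ^ 2 + (s : ℝ)⁻¹ * ‖y‖ ^ 2 := by
    have h3 : 0 ≤ (s : ℝ)⁻¹ * (s * ‖x‖ - ‖y‖) ^ 2 := by positivity
    have h4 : (s : ℝ)⁻¹ * (s * ‖x‖ - ‖y‖) ^ 2 =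
        s * ‖x‖ ^ 2 - 2 * ‖x‖ * ‖y‖ + (s : ℝ)⁻¹ * ‖y‖ ^ 2 := by
      field_simp
      ring
    linarith
  nlinarith

/-- Young's inequality for `√A x = √A T* x + √A (1 - T)* x`. For small `s` the first coefficient is
near `1`; the large second one multiplies a term whose trace will be small. -/
lemma le_smul_conj_add {A : H →L[ℂ] H} (hA : A.IsPositive) (T : H →L[ℂ] H) {s : ℝ≥0}
    (hs : 0 < s) :
    A ≤ (((1 + s : ℝ≥0) : ℝ) : ℂ) • (T ∘L A ∘L adjoint T) +
      (((1 + s⁻¹ : ℝ≥0) : ℝ) : ℂ) • ((1 - T) ∘L A ∘L adjoint (1 - T)) := by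
  have h1 := isPositive_smul (hA.conj_adjoint T) (1 + s)
  have h2 := isPositive_smul (hA.conj_adjoint (1 - T)) (1 + s⁻¹)
  refine le_of_quadForm_le hA (h1.add h2) fun x => ?_
  rw [quadForm_add h1 h2, quadForm_smul, quadForm_smul, quadForm_conj, quadForm_conj,
    quadForm_eq_sqrt hA, quadForm_eq_sqrt hA, quadForm_eq_sqrt hA]
  refine le_trans (le_of_eq ?_) (enorm_add_sq_le hs _ _)
  rw [← map_add, map_sub]
  congr 3
  have : adjoint (1 : H →L[ℂ] H) = 1 := ContinuousLinearMap.adjoint_id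
  simp [this]

lemma IsDecomposition.conj {X : Type*} {k : ℕ} {τ : X → H →L[ℂ] H} {A : H →L[ℂ] H}
    (h : IsDecomposition k τ A) (T : H →L[ℂ] H) :
    IsDecomposition k (fun i => T ∘L τ i ∘L adjoint T) (T ∘L A ∘L adjoint T) := by
  refine ⟨fun i => (h.isPositive i).conj_adjoint T, fun i => (rank_conj_le _ _ _).trans
    (h.rank_le i), fun x => ?_⟩
  simp_rw [quadForm_conj]
  exact h.tsum_quadForm _

lemma IsDecomposition.tsum_posTrace {X : Type*} {k : ℕ} {τ : X → H →L[ℂ] H} {A : H →L[ℂ] H}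
    (h : IsDecomposition k τ A) : ∑' i, posTrace (τ i) = posTrace A :=
  posTrace_tsum h.tsum_quadForm

/-- `T` carries each decomposition of `B` to one of `T B T* ≤ A`. The error terms `(1 - T) τ i (1 -
T)*` still have rank at most `k` and total trace at most `e`, so their entropies sum to at most `e *
cost k⁻¹`, however many terms there are. -/
theorem appr_le_of_le {k : ℕ} (hk : 1 ≤ k) {A B : H →L[ℂ] H} (hA : A.IsPositive) (hAB : A ≤ B)
    (htr : posTrace B < ⊤) {e : ℝ≥0∞} (he : posTrace B < posTrace A + e)
    {p q s : ℝ≥0} (hs : 0 < s) (hpq : p + q ≤ 1) :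
    appr k B ≤ ((1 + s : ℝ≥0) : ℝ≥0∞) * (appr k A + posTrace A * cost p) +
      ((1 + s⁻¹ : ℝ≥0) : ℝ≥0∞) * (e * (cost (k : ℝ≥0)⁻¹ + cost q)) := by
  have hB := isPositive_mono hAB hA
  have hAtr := (posTrace_mono hAB).trans_lt htr
  obtain ⟨T, hT1, hT2⟩ := exists_transport hA hAB htr (tsub_pos_of_lt he)
  rw [add_tsub_cancel_of_le he.le, add_comm _ e] at hT2
  replace hT2 := ENNReal.le_of_add_le_add_right hAtr.ne hT2
  have hCpos := hB.conj_adjoint T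
  have hCtr := (posTrace_mono hT1).trans_lt hAtr
  refine iSup₂_le fun τ h => ?_
  set c1 := 1 + s with hc1
  set c2 := 1 + s⁻¹ with hc2
  set R := fun i => T ∘L τ i ∘L adjoint T with hR
  set D := fun i => (1 - T) ∘L τ i ∘L adjoint (1 - T) with hD
  have hRd : IsDecomposition k R _ := h.conj T
  have hDd : IsDecomposition k D _ := h.conj (1 - T)
  have htrR := hRd.posTrace_lt_top hCtr
  have htrD : ∀ i, posTrace (D i) < ⊤ := by
    intro i
    obtain ⟨ι, g, -⟩ := exists_isEigenbasis hA hAtr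
    rw [hD]
    dsimp only
    rw [posTrace_conj_eq (h.isPositive i) _ g]
    calc _ ≤ ∑' j, ‖(1 - T : H →L[ℂ] H)‖ₑ ^ 2 * ‖CFC.sqrt (τ i) (g j)‖ₑ ^ 2 := by
          refine ENNReal.tsum_le_tsum fun j => ?_
          rw [← mul_pow]
          gcongr
          exact ContinuousLinearMap.le_opENorm _ _
      _ < ⊤ := by
          rw [ENNReal.tsum_mul_left]
          simp_rw [← quadForm_eq_sqrt (h.isPositive i)]
          rw [← posTrace_eq_tsum (h.isPositive i)]
          exact ENNReal.mul_lt_top (by simp) (h.posTrace_lt_top htr i)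
  have hterm : ∀ i, ent (τ i) ≤ c1 * (ent (R i) + posTrace (R i) * cost p) +
      c2 * (posTrace (D i) * (cost (k : ℝ≥0)⁻¹ + cost q)) := by
    intro i
    have hp1 := isPositive_smul (hRd.isPositive i) c1
    have hp2 := isPositive_smul (hDd.isPositive i) c2
    have ht1 : posTrace (((c1 : ℝ) : ℂ) • R i) < ⊤ := by
      rw [posTrace_smul]; exact ENNReal.mul_lt_top (by simp) (htrR i)
    have ht2 : posTrace (((c2 : ℝ) : ℂ) • D i) < ⊤ := by
      rw [posTrace_smul]; exact ENNReal.mul_lt_top (by simp) (htrD i)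
    calc ent (τ i) ≤ ent (((c1 : ℝ) : ℂ) • R i + ((c2 : ℝ) : ℂ) • D i) :=
          ent_mono (h.isPositive i) (le_smul_conj_add (h.isPositive i) T hs)
            (posTrace_ne_top_add hp1 hp2 ht1 ht2)
      _ ≤ c1 * ent (R i) + c2 * ent (D i) +
          (c1 * posTrace (R i) * cost p + c2 * posTrace (D i) * cost q) := by
          have := ent_add_le hp1 hp2 ht1 ht2 hpq
          rwa [ent_smul, ent_smul, posTrace_smul, posTrace_smul] at this
      _ ≤ c1 * ent (R i) + c2 * (posTrace (D i) * cost (k : ℝ≥0)⁻¹) +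
          (c1 * posTrace (R i) * cost p + c2 * posTrace (D i) * cost q) := by
          gcongr
          exact ent_le_of_rank (hDd.isPositive i) (htrD i) (hDd.rank_le i)
      _ = _ := by ring
  calc ∑' i, ent (τ i) ≤ ∑' i, (c1 * (ent (R i) + posTrace (R i) * cost p) +
        c2 * (posTrace (D i) * (cost (k : ℝ≥0)⁻¹ + cost q))) := ENNReal.tsum_le_tsum hterm
    _ = c1 * (∑' i, ent (R i) + (∑' i, posTrace (R i)) * cost p) +
        c2 * ((∑' i, posTrace (D i)) * (cost (k : ℝ≥0)⁻¹ + cost q)) := by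
        rw [ENNReal.tsum_add, ENNReal.tsum_mul_left, ENNReal.tsum_mul_left, ENNReal.tsum_add,
          ENNReal.tsum_mul_right, ENNReal.tsum_mul_right]
    _ ≤ _ := by
        rw [hRd.tsum_posTrace, hDd.tsum_posTrace]
        gcongr
        · exact tsum_ent_le_appr hk hRd hCpos hT1 hAtr
        · exact posTrace_mono hT1

lemma le_add_abs_sub {A B : H →L[ℂ] H} (hA : A.IsPositive) (hB : B.IsPositive) :
    A ≤ B + CFC.abs (A - B) := by
  have := le_abs_self (hA.isSelfAdjoint.sub hB.isSelfAdjoint)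
  rwa [sub_le_iff_le_add'] at this

lemma traceNorm_sub_comm (A B : H →L[ℂ] H) : traceNorm (A - B) = traceNorm (B - A) := by
  rw [← traceNorm_neg, neg_sub]

lemma posTrace_le_add_traceNorm {A B : H →L[ℂ] H} (hA : A.IsPositive) (hB : B.IsPositive) :
    posTrace A ≤ posTrace B + traceNorm (A - B) := by
  rw [traceNorm, ← posTrace_add hB (isPositive_abs _)]
  exact posTrace_mono (le_add_abs_sub hA hB)

/-- `p = exp (-x)` with `x` small, and `q = 1 - p`: the cost of `q` is finite but may be large. -/
lemma exists_cost_mul_le {M η : ℝ≥0∞} (hM : M ≠ ⊤) (hη : 0 < η) :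
    ∃ p q : ℝ≥0, p + q ≤ 1 ∧ p ≠ 0 ∧ q ≠ 0 ∧ M * cost p ≤ η := by
  obtain ⟨x, hx0, hx⟩ := ENNReal.exists_nnreal_pos_mul_lt hM hη.ne'
  have hlt : Real.exp (-x) < 1 := Real.exp_lt_one_iff.2 (by simpa using hx0)
  have hpos := Real.exp_pos (-x)
  have hp1 : (Real.exp (-x)).toNNReal < 1 := by simpa using hlt
  have hp0 : (Real.exp (-x)).toNNReal ≠ 0 := by simpa using hpos
  refine ⟨(Real.exp (-x)).toNNReal, 1 - (Real.exp (-x)).toNNReal,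
    (add_tsub_cancel_of_le hp1.le).le, hp0, (tsub_pos_of_lt hp1).ne', ?_⟩
  rw [cost, if_neg hp0, Real.coe_toNNReal _ hpos.le, Real.log_exp, neg_neg,
    ENNReal.ofReal_coe_nnreal, mul_comm]
  exact hx.le

theorem tendsto_appr_of_tendsto {k : ℕ} (hk : 1 ≤ k) {A : ℕ → H →L[ℂ] H} {A₀ : H →L[ℂ] H}
    (hA : ∀ n, (A n).IsPositive) (hA₀ : A₀.IsPositive) (htr : posTrace A₀ < ⊤)
    (h : Tendsto (fun n => traceNorm (A n - A₀)) atTop (𝓝 0)) :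
    Tendsto (fun n => appr k (A n)) atTop (𝓝 (appr k A₀)) := by
  rw [ENNReal.tendsto_nhds (appr_lt_top hk htr).ne]
  intro η hη
  have hη3 : 0 < η / 3 := ENNReal.div_pos hη.ne' (by simp)
  set ck := cost (k : ℝ≥0)⁻¹ with hck
  have hck' : ck ≠ ⊤ := cost_ne_top (inv_ne_zero (by exact_mod_cast (by omega : k ≠ 0)))
  set T := posTrace A₀ + 1 with hT
  have hT' : T ≠ ⊤ := by rw [hT]; exact ENNReal.add_ne_top.2 ⟨htr.ne, by simp⟩
  -- The constants are fixed in the order `s`, then `p` and `q`, then `e'`, each keeping one error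
  -- term below `η / 3`; `e'` comes last because it has to beat `cost q` and `1 + s⁻¹`.
  obtain ⟨s, hs0, hs⟩ := ENNReal.exists_nnreal_pos_mul_lt (ENNReal.mul_ne_top hT' hck') hη3.ne'
  obtain ⟨p, q, hpq, -, hq0, hp⟩ := exists_cost_mul_le (M := ((1 + s : ℝ≥0) : ℝ≥0∞) * T)
    (ENNReal.mul_ne_top (by simp) hT') hη3
  obtain ⟨e', he0, he⟩ := ENNReal.exists_nnreal_pos_mul_lt
    (a := ((1 + s⁻¹ : ℝ≥0) : ℝ≥0∞) * (ck + cost q))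
    (ENNReal.mul_ne_top (by simp) (ENNReal.add_ne_top.2 ⟨hck', cost_ne_top hq0⟩)) hη3.ne'
  have hfinal : ∀ B C : H →L[ℂ] H, B.IsPositive → C.IsPositive → posTrace B ≤ T →
      posTrace C < ⊤ → posTrace B < ⊤ → traceNorm (C - B) + traceNorm (C - B) < e' →
      appr k C ≤ appr k B + η := by
    intro B C hB hC hBT hCt hBt hlt
    have hfin : traceNorm (C - B) < ⊤ :=
      lt_of_le_of_lt le_self_add (hlt.trans (by simp))
    -- `B` and `C` need not be comparable, but both lie below `W`, whose trace exceeds that of `B`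
    -- by the trace norm of `C - B`. Monotonicity passes from `C` up to `W`, and `appr_le_of_le`
    -- down to `B`.
    set W := B + CFC.abs (C - B) with hW
    have hBW : B ≤ W := by
      rw [hW]; exact le_add_of_nonneg_right (CFC.abs_nonneg _)
    have hWtr' : posTrace W = posTrace B + traceNorm (C - B) := by
      rw [hW, posTrace_add hB (isPositive_abs _)]; rfl
    have hWtr : posTrace W < ⊤ := by
      rw [hWtr']; exact ENNReal.add_lt_top.2 ⟨hBt, hfin⟩
    have hWe : posTrace W < posTrace B + e' := by
      rw [hWtr']
      exact ENNReal.add_lt_add_left hBt.ne (lt_of_le_of_lt le_self_add hlt)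
    calc appr k C ≤ appr k W := appr_mono hk hC (le_add_abs_sub hC hB) hWtr
      _ ≤ ((1 + s : ℝ≥0) : ℝ≥0∞) * (appr k B + posTrace B * cost p) +
          ((1 + s⁻¹ : ℝ≥0) : ℝ≥0∞) * (e' * (ck + cost q)) :=
          appr_le_of_le hk hB hBW hWtr hWe hs0 hpq
      _ = appr k B + (s * appr k B + ((1 + s : ℝ≥0) : ℝ≥0∞) * posTrace B * cost p +
          e' * (((1 + s⁻¹ : ℝ≥0) : ℝ≥0∞) * (ck + cost q))) := by
          push_cast; ring
      _ ≤ appr k B + (s * (T * ck) + ((1 + s : ℝ≥0) : ℝ≥0∞) * T * cost p +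
          e' * (((1 + s⁻¹ : ℝ≥0) : ℝ≥0∞) * (ck + cost q))) := by
          gcongr
          exact (appr_le_posTrace k hBt).trans (by gcongr)
      _ ≤ appr k B + (η / 3 + η / 3 + η / 3) := by
          gcongr
      _ = appr k B + η := by rw [ENNReal.add_thirds]
  have h2 : Tendsto (fun n => traceNorm (A n - A₀) + traceNorm (A n - A₀)) atTop (𝓝 0) := by
    simpa using h.add h
  filter_upwards [h2.eventually_lt_const (u := (e' : ℝ≥0∞)) (by simpa using he0),
    h.eventually_lt_const (u := 1) (by simp)] with n hn1 hn2
  have hnT : posTrace (A n) ≤ T :=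
    (posTrace_le_add_traceNorm (hA n) hA₀).trans (by rw [hT]; gcongr)
  have hnt : posTrace (A n) < ⊤ := hnT.trans_lt hT'.lt_top
  constructor
  · rw [tsub_le_iff_right]
    refine hfinal _ _ (hA n) hA₀ hnT htr hnt ?_
    rwa [traceNorm_sub_comm]
  · exact hfinal _ _ hA₀ (hA n) (by rw [hT]; exact le_self_add) hnt htr hn1

/-! ### The entropy loss under finitely many Kraus operators -/

lemma krausMap_add {J : Type*} [Fintype J] (V : J → H →L[ℂ] K) (A B : H →L[ℂ] H) :
    krausMap V (A + B) = krausMap V A + krausMap V B := by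
  simp only [krausMap]
  rw [← Finset.sum_add_distrib]
  refine Finset.sum_congr rfl fun j _ => ?_
  ext x
  simp

lemma rank_krausMap_le {J : Type*} [Fintype J] (V : J → H →L[ℂ] K) {A : H →L[ℂ] H} {k : ℕ}
    (hA : (A : H →ₗ[ℂ] H).rank ≤ (k : Cardinal)) :
    (krausMap V A : K →ₗ[ℂ] K).rank ≤ ((Fintype.card J * k : ℕ) : Cardinal) := by
  have h1 : (krausMap V A : K →ₗ[ℂ] K) = ∑ j, (V j : H →ₗ[ℂ] K) ∘ₗ
      ((A : H →ₗ[ℂ] H) ∘ₗ (adjoint (V j) : K →ₗ[ℂ] H)) := by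
    ext x
    simp [krausMap]
  rw [h1]
  refine (LinearMap.rank_finsetSum_le _ _).trans ?_
  calc _ ≤ ∑ _j : J, (k : Cardinal) := by
        refine Finset.sum_le_sum fun j _ => ?_
        have h2 := (LinearMap.lift_rank_comp_le_right
          ((A : H →ₗ[ℂ] H) ∘ₗ (adjoint (V j) : K →ₗ[ℂ] H)) (V j : H →ₗ[ℂ] K))
        have h3 := Cardinal.lift_le.2 ((LinearMap.rank_comp_le_left
          (adjoint (V j) : K →ₗ[ℂ] H) (A : H →ₗ[ℂ] H)).trans hA)
        have h4 := h2.trans h3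
        simpa using h4
    _ = _ := by simp

lemma diagOp_one_comp_self {ι : Type*} (b : HilbertBasis ι ℂ H) (F : Finset ι) :
    diagOp b F 1 ∘L diagOp b F 1 = diagOp b F 1 := by
  classical
  ext x
  rw [ContinuousLinearMap.comp_apply, diagOp_apply, diagOp_apply]
  refine Finset.sum_congr rfl fun i hi => ?_
  rw [← diagOp_apply, inner_diagOp, if_pos hi]
  simp

lemma diagOp_one_conj {ι : Type*} {A : H →L[ℂ] H} {b : HilbertBasis ι ℂ H} {l : ι → ℝ≥0}
    (h : IsEigenbasis A b l) (F : Finset ι) :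
    diagOp b F 1 ∘L A ∘L diagOp b F 1 = diagOp b F l := by
  classical
  ext x
  simp only [ContinuousLinearMap.comp_apply]
  rw [diagOp_apply b F 1 x, map_sum, map_sum, diagOp_apply]
  refine Finset.sum_congr rfl fun i hi => ?_
  rw [map_smul, map_smul, map_smul, map_smul, h i, map_smul, diagOp_basis, if_pos hi, smul_smul,
    smul_smul, smul_smul, smul_smul]
  congr 1
  simp [mul_comm]

lemma posTrace_conj_le_of_norm_le {A : H →L[ℂ] H} (hA : A.IsPositive) {B : H →L[ℂ] K}
    (hB : ∀ x, ‖B x‖ₑ ^ 2 ≤ ‖x‖ₑ ^ 2) : posTrace (B ∘L A ∘L adjoint B) ≤ posTrace A := by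
  have := posTrace_krausMap_le (J := Unit) (V := fun _ => B) (by simpa using hB) hA
  simpa [krausMap] using this

lemma enorm_diagOp_one_sq_le {ι : Type*} (b : HilbertBasis ι ℂ H) (F : Finset ι) (x : H) :
    ‖diagOp b F 1 x‖ₑ ^ 2 ≤ ‖x‖ₑ ^ 2 := by
  classical
  rw [← tsum_enorm_inner_sq b, ← tsum_enorm_inner_sq b x]
  refine ENNReal.tsum_le_tsum fun i => ?_
  rw [inner_diagOp]
  split_ifs <;> simp

/-- In the eigenbasis of `A₀` the complementary projection keeps the vectors outside `F`; there `A ≤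
A₀ + |A - A₀|` bounds the diagonal entries. -/
lemma posTrace_compl_conj_le {ι : Type*} {A A₀ : H →L[ℂ] H} (hA : A.IsPositive)
    (hA₀ : A₀.IsPositive) {b : HilbertBasis ι ℂ H} {l : ι → ℝ≥0} (h : IsEigenbasis A₀ b l)
    (F : Finset ι) :
    posTrace ((1 - diagOp b F 1) ∘L A ∘L adjoint (1 - diagOp b F 1)) ≤
      (posTrace A₀ - ∑ i ∈ F, (l i : ℝ≥0∞)) + traceNorm (A - A₀) := by
  classical
  rw [posTrace_eq_tsum (hA.conj_adjoint _) b]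
  simp_rw [quadForm_conj]
  have h1 : adjoint (1 - diagOp b F 1) = 1 - diagOp b F 1 := by
    rw [map_sub, adjoint_diagOp]
    congr 1
    exact ContinuousLinearMap.adjoint_id
  have h2 : ∀ i, (1 - diagOp b F 1) (b i) = if i ∈ F then 0 else b i := by
    intro i
    rw [sub_apply, diagOp_basis]
    split_ifs <;> simp
  have h3 : ∑ i ∈ F, (l i : ℝ≥0∞) + ∑' i, (if i ∈ F then 0 else (l i : ℝ≥0∞)) = posTrace A₀ := by
    have h5 : ∑ i ∈ F, (l i : ℝ≥0∞) = ∑' i, (if i ∈ F then (l i : ℝ≥0∞) else 0) := by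
      rw [tsum_eq_sum (s := F) (fun i hi => if_neg hi)]
      exact Finset.sum_congr rfl fun i hi => (if_pos hi).symm
    rw [h5, ← ENNReal.tsum_add, ← h.tsum hA₀]
    refine tsum_congr fun i => ?_
    split_ifs <;> simp
  have h4 : ∑ i ∈ F, (l i : ℝ≥0∞) ≠ ⊤ := by simp
  calc _ ≤ ∑' i, ((if i ∈ F then 0 else (l i : ℝ≥0∞)) + quadForm (CFC.abs (A - A₀)) (b i)) := by
        refine ENNReal.tsum_le_tsum fun i => ?_
        rw [h1, h2]
        split_ifs
        · simp [quadForm]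
        · have := quadForm_mono (le_add_abs_sub hA hA₀) (b i)
          rwa [quadForm_add hA₀ (isPositive_abs _), h.quadForm] at this
    _ = ∑' i, (if i ∈ F then 0 else (l i : ℝ≥0∞)) + traceNorm (A - A₀) := by
        rw [ENNReal.tsum_add, traceNorm, posTrace_eq_tsum (isPositive_abs _) b]
    _ = _ := by rw [← h3, ENNReal.add_sub_cancel_left h4]

/-- The quantitative core of B. Each error term has a factor that can be made small: the distance of
`A` from `A₀`, the cost of `p`, or the eigenvalue tail of `A₀` outside `F`. -/
theorem ent_diagOp_add_ent_krausMap_le {ι : Type*} {A A₀ : H →L[ℂ] H} (hA : A.IsPositive)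
    (hA₀ : A₀.IsPositive) (hAt : posTrace A < ⊤)
    (hD : traceNorm (A - A₀) < ⊤) {b : HilbertBasis ι ℂ H} {l : ι → ℝ≥0}
    (h : IsEigenbasis A₀ b l) {F : Finset ι} {k N : ℕ} (hF : F.card ≤ k)
    {J : Type*} [Fintype J] {V : J → H →L[ℂ] K} (hV : ∀ x, ∑ j, ‖V j x‖ₑ ^ 2 ≤ ‖x‖ₑ ^ 2)
    (hN : Fintype.card J * k ≤ N) (hN1 : 1 ≤ N)
    {w p q : ℝ≥0} (hw : Fintype.card J * w ≤ 1) (hpq : p + q ≤ 1) :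
    ent (diagOp b F l) + ent (krausMap V A) ≤ appr N (krausMap V A) + ent A +
      (traceNorm (A - A₀) * (cost (k : ℝ≥0)⁻¹ + cost w + (cost q + cost q)) +
        (posTrace A * cost p + posTrace A * cost p) +
        (posTrace A₀ - ∑ i ∈ F, (l i : ℝ≥0∞)) * (cost w + cost q)) := by
  set P := diagOp b F 1 with hP
  have hPadj : adjoint P = P := adjoint_diagOp b F 1
  have hPP : P ∘L P = P := diagOp_one_comp_self b F
  have hPrank : (P : H →ₗ[ℂ] H).rank ≤ (k : Cardinal) :=
    (rank_diagOp_le b F 1).trans (by exact_mod_cast hF)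
  have hQadj : adjoint (1 - P) = 1 - P := by
    rw [map_sub, hPadj]
    congr 1
    exact ContinuousLinearMap.adjoint_id
  set R := CFC.sqrt A with hR
  have hRR : R ∘L R = A := sqrt_comp_sqrt hA
  have hRadj : adjoint R = R := adjoint_sqrt A
  set ε := traceNorm (A - A₀) with hε
  set tail := posTrace A₀ - ∑ i ∈ F, (l i : ℝ≥0∞) with htail
  have hαeq : adjoint (P ∘L R) ∘L (P ∘L R) = R ∘L P ∘L R := by
    rw [ContinuousLinearMap.adjoint_comp, hPadj, hRadj]
    conv_rhs => rw [← hPP]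
    rfl
  have hβeq : adjoint ((1 - P) ∘L R) ∘L ((1 - P) ∘L R) = A - R ∘L P ∘L R := by
    rw [ContinuousLinearMap.adjoint_comp, hQadj, hRadj, ← hRR]
    ext x
    have h2 := congrArg (fun T : H →L[ℂ] H => T (R x)) hPP
    simp only [ContinuousLinearMap.comp_apply] at h2
    simp [h2]
  set α := R ∘L P ∘L R with hα
  set β := A - α with hβ
  have hαpos : α.IsPositive := by
    rw [← hαeq]; exact ContinuousLinearMap.isPositive_adjoint_comp_self _
  have hβpos : β.IsPositive := by
    rw [← hβeq]; exact ContinuousLinearMap.isPositive_adjoint_comp_self _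
  have hαβ : α + β = A := add_sub_cancel _ _
  have hαA : α ≤ A := by
    rw [ContinuousLinearMap.le_def]; exact hβpos
  have hβA : β ≤ A := by
    rw [ContinuousLinearMap.le_def, hβ, sub_sub_cancel]; exact hαpos
  have hαt := (posTrace_mono hαA).trans_lt hAt
  have hβt := (posTrace_mono hβA).trans_lt hAt
  have hconj : ∀ Q : H →L[ℂ] H, (Q ∘L R) ∘L adjoint (Q ∘L R) = Q ∘L A ∘L adjoint Q := by
    intro Q
    rw [ContinuousLinearMap.adjoint_comp, hRadj, ← hRR]
    rfl
  have hβtail : posTrace β ≤ tail + ε := by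
    rw [← hβeq, posTrace_comm b b, hconj]
    exact posTrace_compl_conj_le hA hA₀ h F
  have hαrank : (α : H →ₗ[ℂ] H).rank ≤ (k : Cardinal) := (rank_conj_le _ _ _).trans hPrank
  have hPnorm := enorm_diagOp_one_sq_le b F
  -- compare the truncation of `A₀` with `α`
  have hAbs := isPositive_abs (A - A₀)
  have h1 : ent (diagOp b F l) ≤ ent α + (ε * (cost (k : ℝ≥0)⁻¹ + cost q) +
      posTrace A * cost p) := by
    have hX := hA.conj_adjoint P
    have hY := hAbs.conj_adjoint P
    have hXt := (posTrace_conj_le_of_norm_le hA hPnorm).trans_lt hAt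
    have hYε : posTrace (P ∘L CFC.abs (A - A₀) ∘L adjoint P) ≤ ε :=
      posTrace_conj_le_of_norm_le hAbs hPnorm
    have hYt := hYε.trans_lt hD
    have hle : diagOp b F l ≤ P ∘L A ∘L adjoint P + P ∘L CFC.abs (A - A₀) ∘L adjoint P := by
      refine le_of_quadForm_le (isPositive_diagOp b F l) (hX.add hY) fun x => ?_
      rw [← diagOp_one_conj h F, ← hP]
      nth_rewrite 2 [← hPadj]
      rw [quadForm_add hX hY, quadForm_conj, quadForm_conj, quadForm_conj,
        ← quadForm_add hA hAbs]
      refine quadForm_mono ?_ _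
      have := le_add_abs_sub hA₀ hA
      rwa [← CFC.abs_neg, neg_sub] at this
    calc ent (diagOp b F l) ≤ ent (P ∘L A ∘L adjoint P + P ∘L CFC.abs (A - A₀) ∘L adjoint P) :=
          ent_mono (isPositive_diagOp b F l) hle (posTrace_ne_top_add hX hY hXt hYt)
      _ ≤ ent (P ∘L A ∘L adjoint P) + ent (P ∘L CFC.abs (A - A₀) ∘L adjoint P) +
          (posTrace (P ∘L A ∘L adjoint P) * cost p +
            posTrace (P ∘L CFC.abs (A - A₀) ∘L adjoint P) * cost q) :=
          ent_add_le hX hY hXt hYt hpq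
      _ ≤ ent α + ε * cost (k : ℝ≥0)⁻¹ + (posTrace A * cost p + ε * cost q) := by
          gcongr
          -- With `B = P √A`, the compression `P A P` is `B B*` and `α` is `B* B`.
          · rw [← hconj, ← hαeq]
            refine ent_comp_adjoint_le (by rwa [hαeq]) (by rwa [hconj])
          · refine (ent_le_of_rank hY hYt ((LinearMap.rank_comp_le_left
              ((CFC.abs (A - A₀) ∘L adjoint P : H →L[ℂ] H) : H →ₗ[ℂ] H)
              (P : H →ₗ[ℂ] H)).trans hPrank)).trans ?_
            gcongr
          · exact posTrace_conj_le_of_norm_le hA hPnorm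
      _ = _ := by ring
  have h2 : ent α + ent β ≤ ent A := by
    have := ent_add_ent_le hαpos hβpos (by rwa [hαβ])
    rwa [hαβ] at this
  have h3 : ent (krausMap V A) ≤ appr N (krausMap V A) + ent β +
      (posTrace A * cost p + (tail + ε) * (cost w + cost q)) := by
    have hX := isPositive_krausMap V hαpos
    have hY := isPositive_krausMap V hβpos
    have hXA := posTrace_krausMap_le hV hαpos
    have hYB := posTrace_krausMap_le hV hβpos
    have hSt := (posTrace_krausMap_le hV hA).trans_lt hAt
    have hsum : krausMap V A = krausMap V α + krausMap V β := by rw [← krausMap_add, hαβ]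
    calc ent (krausMap V A) ≤ ent (krausMap V α) + ent (krausMap V β) +
          (posTrace (krausMap V α) * cost p + posTrace (krausMap V β) * cost q) := by
          conv_lhs => rw [hsum]
          exact ent_add_le hX hY (hXA.trans_lt hαt) (hYB.trans_lt hβt) hpq
      _ ≤ appr N (krausMap V A) + (ent β + posTrace β * cost w) +
          (posTrace A * cost p + posTrace β * cost q) := by
          gcongr
          -- The image of `α` has rank at most `N` and lies below the image of `A`.
          · refine ent_le_appr hN1 hX ((rank_krausMap_le V hαrank).trans (by exact_mod_cast hN))
              ?_ hSt
            rw [hsum]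
            exact le_add_of_nonneg_right ((ContinuousLinearMap.nonneg_iff_isPositive _).2 hY)
          · exact ent_krausMap_le hV hβpos hβt hw
          · exact hXA.trans (posTrace_mono hαA)
      _ = appr N (krausMap V A) + ent β + (posTrace A * cost p +
          posTrace β * (cost w + cost q)) := by ring
      _ ≤ _ := by gcongr
  calc _ ≤ (ent α + (ε * (cost (k : ℝ≥0)⁻¹ + cost q) + posTrace A * cost p)) +
        (appr N (krausMap V A) + ent β +
          (posTrace A * cost p + (tail + ε) * (cost w + cost q))) := add_le_add h1 h3
    _ = (ent α + ent β) + (appr N (krausMap V A) +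
          (ε * (cost (k : ℝ≥0)⁻¹ + cost w + (cost q + cost q)) +
            (posTrace A * cost p + posTrace A * cost p) + tail * (cost w + cost q))) := by ring
    _ ≤ ent A + (appr N (krausMap V A) +
          (ε * (cost (k : ℝ≥0)⁻¹ + cost w + (cost q + cost q)) +
            (posTrace A * cost p + posTrace A * cost p) + tail * (cost w + cost q))) := by gcongr
    _ = _ := by ring

lemma card_mul_inv_succ_le {d m : ℕ} (hd : d ≤ m) :
    (Fintype.card (Fin d) : ℝ≥0) * ((m + 1 : ℕ) : ℝ≥0)⁻¹ ≤ 1 := by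
  rw [Fintype.card_fin]
  calc (d : ℝ≥0) * ((m + 1 : ℕ) : ℝ≥0)⁻¹ ≤ ((m + 1 : ℕ) : ℝ≥0) * ((m + 1 : ℕ) : ℝ≥0)⁻¹ := by
        gcongr; omega
    _ ≤ 1 := mul_inv_le_one

lemma cost_inv_succ_ne_top (m : ℕ) : cost ((m + 1 : ℕ) : ℝ≥0)⁻¹ ≠ ⊤ :=
  cost_ne_top (inv_ne_zero (by positivity))

/-- Entropy zero is treated apart, since no value lies strictly below it. -/
lemma IsEigenbasis.eventually_ent_le_add {ι : Type*} {A : H →L[ℂ] H} {b : HilbertBasis ι ℂ H}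
    {l : ι → ℝ≥0} (h : IsEigenbasis A b l) (hA : A.IsPositive) (htr : posTrace A < ⊤)
    (hfin : ent A ≠ ⊤) {δ : ℝ≥0∞} (hδ : 0 < δ) :
    ∀ᶠ F in atTop, ent A ≤ ent (diagOp b F l) + δ ∧ posTrace A - ∑ i ∈ F, (l i : ℝ≥0∞) ≤ δ := by
  rcases eq_or_ne (ent A) 0 with h0 | h0
  · filter_upwards [(h.tendsto_posTrace_sub hA htr).eventually_lt_const hδ] with F hF
    exact ⟨by simp [h0], hF.le⟩
  · have hδ2 : 0 < δ / 2 := ENNReal.div_pos hδ.ne' (by simp)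
    filter_upwards [h.eventually_lt_ent_diagOp hA htr
      (ENNReal.sub_lt_self hfin h0 hδ2.ne') hδ2] with F hF
    refine ⟨?_, hF.2.trans ENNReal.half_le_self⟩
    calc ent A ≤ ent A - δ / 2 + δ / 2 := le_tsub_add
      _ ≤ ent (diagOp b F l) + δ / 2 + δ / 2 := by gcongr; exact hF.1
      _ = ent (diagOp b F l) + δ := by rw [add_assoc, ENNReal.add_halves]

/-- Inequality B in additive form, meaningful for infinite upper limits. -/
theorem ent_add_limsup_ent_krausMap_le {A : ℕ → H →L[ℂ] H} {A₀ : H →L[ℂ] H}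
    (hA : ∀ n, (A n).IsPositive) (hAt : ∀ n, posTrace (A n) < ⊤) (hA₀ : A₀.IsPositive)
    (htr : posTrace A₀ < ⊤) (hfin : ent A₀ ≠ ⊤)
    (h : Tendsto (fun n => traceNorm (A n - A₀)) atTop (𝓝 0))
    {m : ℕ} {d : ℕ → ℕ} (hd : ∀ n, d n ≤ m) {V : ∀ n, Fin (d n) → H →L[ℂ] K}
    (hV : ∀ n x, ∑ j, ‖V n j x‖ₑ ^ 2 ≤ ‖x‖ₑ ^ 2) {S₀ : K →L[ℂ] K} (hS₀ : S₀.IsPositive)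
    (hS₀t : posTrace S₀ < ⊤)
    (hS : Tendsto (fun n => traceNorm (krausMap (V n) (A n) - S₀)) atTop (𝓝 0)) :
    ent A₀ + limsup (fun n => ent (krausMap (V n) (A n))) atTop ≤
      ent S₀ + limsup (fun n => ent (A n)) atTop := by
  obtain ⟨ι, b, l, hb⟩ := exists_isEigenbasis hA₀ htr
  suffices hmain : ∀ η : ℝ≥0∞, 0 < η →
      ent A₀ + limsup (fun n => ent (krausMap (V n) (A n))) atTop ≤
        (ent S₀ + limsup (fun n => ent (A n)) atTop) + (η + η + η + η + η) by
    refine ENNReal.le_of_forall_pos_le_add fun δ hδ _ => ?_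
    refine (hmain (δ / 5) (ENNReal.div_pos (by simpa using hδ.ne') (by simp))).trans ?_
    gcongr
    refine le_of_eq ?_
    rw [← ENNReal.add_div, ← ENNReal.add_div, ← ENNReal.add_div, ← ENNReal.add_div]
    rw [show (δ + δ + δ + δ + δ : ℝ≥0∞) = δ * 5 by ring,
      ENNReal.mul_div_cancel_right (by simp) (by simp)]
  intro η hη
  -- The shift to `m + 1` keeps the cost finite even for `m = 0`.
  set w : ℝ≥0 := ((m + 1 : ℕ) : ℝ≥0)⁻¹ with hw
  have hwtop : cost w ≠ ⊤ := cost_inv_succ_ne_top m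
  set T := posTrace A₀ + 1 with hT
  have hT' : T ≠ ⊤ := by rw [hT]; exact ENNReal.add_ne_top.2 ⟨htr.ne, by simp⟩
  -- Order of choice: `p` and `q`, then the tail bound `δ`, then the truncation `F` with `k` and
  -- `N`, and finally the distance `e`, which has to beat `cost k⁻¹`.
  obtain ⟨p, q, hpq, -, hq0, hp⟩ := exists_cost_mul_le (M := T + T)
    (ENNReal.add_ne_top.2 ⟨hT', hT'⟩) hη
  have hqtop := cost_ne_top hq0
  obtain ⟨δ, hδ0, hδ⟩ := ENNReal.exists_nnreal_pos_mul_lt (a := cost w + cost q)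
    (ENNReal.add_ne_top.2 ⟨hwtop, hqtop⟩) hη.ne'
  obtain ⟨F, hF1, hF2⟩ := (hb.eventually_ent_le_add hA₀ htr hfin
    (show 0 < min η δ from lt_min hη (by simpa using hδ0))).exists
  set k := F.card + 1 with hk
  have hktop : cost (k : ℝ≥0)⁻¹ ≠ ⊤ := cost_inv_succ_ne_top _
  -- `N` bounds the rank of the image of `α` for all `n` at once, so continuity of a single
  -- approximator suffices.
  set N := m * k + 1 with hN
  have happr := tendsto_appr_of_tendsto (k := N) (Nat.le_add_left 1 _)
    (fun n => isPositive_krausMap (V n) (hA n)) hS₀ hS₀t hS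
  obtain ⟨e, he0, he⟩ := ENNReal.exists_nnreal_pos_mul_lt
    (a := cost (k : ℝ≥0)⁻¹ + cost w + (cost q + cost q))
    (ENNReal.add_ne_top.2 ⟨ENNReal.add_ne_top.2 ⟨hktop, hwtop⟩,
      ENNReal.add_ne_top.2 ⟨hqtop, hqtop⟩⟩) hη.ne'
  have hev : ∀ᶠ n in atTop, ent A₀ + ent (krausMap (V n) (A n)) ≤
      (ent S₀ + (η + η + η + η + η)) + ent (A n) := by
    have happrfin := (appr_lt_top (k := N) (Nat.le_add_left 1 _) hS₀t).ne
    filter_upwards [h.eventually_lt_const (u := (e : ℝ≥0∞)) (by simpa using he0),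
      h.eventually_lt_const (u := 1) (by simp),
      happr.eventually_lt_const (ENNReal.lt_add_right happrfin hη.ne')] with n hn1 hn2 hn3
    have hnT : posTrace (A n) ≤ T :=
      (posTrace_le_add_traceNorm (hA n) hA₀).trans (by rw [hT]; gcongr)
    calc ent A₀ + ent (krausMap (V n) (A n)) ≤ ent (diagOp b F l) + η + ent (krausMap (V n) (A n)) := by
          gcongr
          exact hF1.trans (by gcongr; exact min_le_left _ _)
      _ = (ent (diagOp b F l) + ent (krausMap (V n) (A n))) + η := by ring
      _ ≤ appr N (krausMap (V n) (A n)) + ent (A n) +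
          (traceNorm (A n - A₀) * (cost (k : ℝ≥0)⁻¹ + cost w + (cost q + cost q)) +
            (posTrace (A n) * cost p + posTrace (A n) * cost p) +
            (posTrace A₀ - ∑ i ∈ F, (l i : ℝ≥0∞)) * (cost w + cost q)) + η := by
          refine add_le_add ?_ le_rfl
          refine ent_diagOp_add_ent_krausMap_le (F := F) (k := k) (N := N) (hA n) hA₀ (hAt n)
            (hn2.trans (by simp)) hb (Nat.le_succ _) (hV n) ?_ (Nat.le_add_left 1 _) (card_mul_inv_succ_le (hd n)) hpq
          rw [Fintype.card_fin, hN]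
          exact (Nat.mul_le_mul_right _ (hd n)).trans (Nat.le_succ _)
      _ ≤ (ent S₀ + η) + ent (A n) + (η + η + η) + η := by
          gcongr
          · exact hn3.le.trans (by gcongr; exact appr_le_ent N hS₀ hS₀t)
          · exact le_trans (by gcongr) he.le
          · rw [← add_mul]
            exact le_trans (by gcongr) hp
          · refine le_trans ?_ hδ.le
            gcongr
            exact hF2.trans (min_le_right _ _)
      _ = _ := by ring
  calc _ = limsup (fun n => ent A₀ + ent (krausMap (V n) (A n))) atTop :=
        (limsup_const_add atTop _ _ (by isBoundedDefault) (by isBoundedDefault)).symm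
    _ ≤ limsup (fun n => (ent S₀ + (η + η + η + η + η)) + ent (A n)) atTop := limsup_le_limsup hev
    _ = (ent S₀ + (η + η + η + η + η)) + limsup (fun n => ent (A n)) atTop :=
        limsup_const_add atTop _ _ (by isBoundedDefault) (by isBoundedDefault)
    _ = _ := by ring

/-- Continuity of the approximators makes the entropy lower semicontinuous; combined with the Kraus
bound, this forces the limit output to have finite entropy when the input entropies have finite
upper limit. -/
theorem ent_le_limsup_of_krausMap {A : ℕ → H →L[ℂ] H} {A₀ : H →L[ℂ] H}
    (hA : ∀ n, (A n).IsPositive) (hAt : ∀ n, posTrace (A n) < ⊤) (hA₀ : A₀.IsPositive)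
    (h : Tendsto (fun n => traceNorm (A n - A₀)) atTop (𝓝 0))
    {m : ℕ} {d : ℕ → ℕ} (hd : ∀ n, d n ≤ m) {V : ∀ n, Fin (d n) → H →L[ℂ] K}
    (hV : ∀ n x, ∑ j, ‖V n j x‖ₑ ^ 2 ≤ ‖x‖ₑ ^ 2) {S₀ : K →L[ℂ] K} (hS₀ : S₀.IsPositive)
    (hS₀t : posTrace S₀ < ⊤)
    (hS : Tendsto (fun n => traceNorm (krausMap (V n) (A n) - S₀)) atTop (𝓝 0)) :
    ent S₀ ≤ limsup (fun n => ent (A n)) atTop +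
      (posTrace A₀ + 1) * cost ((m + 1 : ℕ) : ℝ≥0)⁻¹ := by
  refine le_of_tendsto (tendsto_appr hS₀ hS₀t) ?_
  filter_upwards [eventually_ge_atTop 1] with k hk
  have happr := tendsto_appr_of_tendsto hk (fun n => isPositive_krausMap (V n) (hA n)) hS₀ hS₀t hS
  rw [← happr.limsup_eq, ← limsup_add_const atTop _ _ (by isBoundedDefault) (by isBoundedDefault)]
  refine limsup_le_limsup ?_
  filter_upwards [h.eventually_lt_const (u := 1) (by simp)] with n hn
  have hSt := (posTrace_krausMap_le (hV n) (hA n)).trans_lt (hAt n)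
  refine (appr_le_ent k (isPositive_krausMap (V n) (hA n)) hSt).trans
    ((ent_krausMap_le (hV n) (hA n) (hAt n) (card_mul_inv_succ_le (hd n))).trans ?_)
  gcongr
  exact (posTrace_le_add_traceNorm (hA n) hA₀).trans (by gcongr)

/-! ### Stinespring representations -/

lemma exists_hasStinespring_of_choiRank_le {Φ : QuantumOperation H K} {m : ℕ}
    (h : choiRank Φ ≤ (m : ℕ∞)) : ∃ d ≤ m, HasStinespring Φ d := by
  by_contra! hcon
  have h1 : ((m + 1 : ℕ) : ℕ∞) ≤ choiRank Φ := by
    refine le_iInf₂ fun d hd => ?_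
    by_contra! hlt
    exact hcon d (by have : d < m + 1 := by exact_mod_cast hlt
                     omega) hd
  have h2 := h1.trans h
  have h3 : m + 1 ≤ m := by exact_mod_cast h2
  omega

lemma posTrace_rankOne (x : H) : posTrace (InnerProductSpace.rankOne ℂ x x) = ‖x‖ₑ ^ 2 := by
  obtain ⟨w, g, -⟩ := exists_hilbertBasis ℂ H
  rw [posTrace_eq_tsum (InnerProductSpace.isPositive_rankOne_self x) g, ← tsum_enorm_inner_sq g x]
  refine tsum_congr fun i => ?_
  rw [quadForm, InnerProductSpace.rankOne_apply, inner_smul_right, ← inner_conj_symm x (g i),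
    ← Complex.normSq_eq_conj_mul_self, enorm_sq_eq_ofReal, Complex.normSq_eq_norm_sq]
  congr 1

/-- The Kraus operators are the components of the Stinespring operator. Trace non-increase, tested
on `|x⟩⟨x|`, gives the norm bound. -/
lemma exists_krausMap_of_hasStinespring {Φ : QuantumOperation H K} {d : ℕ}
    (h : HasStinespring Φ d) :
    ∃ V : Fin d → H →L[ℂ] K, (∀ x, ∑ j, ‖V j x‖ₑ ^ 2 ≤ ‖x‖ₑ ^ 2) ∧
      ∀ A : TraceClass H, (Φ.toLinearMap A : K →L[ℂ] K) = krausMap V (A : H →L[ℂ] H) := by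
  obtain ⟨W, hW⟩ := h
  set V : Fin d → H →L[ℂ] K := fun j => PiLp.proj 2 (𝕜 := ℂ) (fun _ : Fin d => K) j ∘L W with hV
  have hΦ : ∀ A : TraceClass H,
      (Φ.toLinearMap A : K →L[ℂ] K) = krausMap V (A : H →L[ℂ] H) := by
    intro A
    rw [hW, partialTrace, krausMap]
    refine Finset.sum_congr rfl fun j _ => ?_
    rw [hV]
    dsimp only
    rw [ContinuousLinearMap.adjoint_comp]
    rfl
  refine ⟨V, fun x => ?_, hΦ⟩
  have hpos := InnerProductSpace.isPositive_rankOne_self (𝕜 := ℂ) x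
  have hmem : InnerProductSpace.rankOne ℂ x x ∈ TraceClass H :=
    mem_traceClass hpos (by rw [posTrace_rankOne]; simp)
  have h1 := Φ.trace_le ⟨_, hmem⟩ hpos
  rw [hΦ] at h1
  simp only [posTrace_rankOne] at h1
  refine le_trans (le_of_eq ?_) h1
  have h2 : krausMap V (InnerProductSpace.rankOne ℂ x x) =
      ∑ j, InnerProductSpace.rankOne ℂ (V j x) (V j x) := by
    refine Finset.sum_congr rfl fun j _ => ?_
    ext y
    simp [ContinuousLinearMap.adjoint_inner_right]
  rw [h2, posTrace_sum fun j => InnerProductSpace.isPositive_rankOne_self (V j x)]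
  simp_rw [posTrace_rankOne]

/-- Complete positivity for blocks of size one; over `ℂ`, a nonnegative quadratic form already
forces self-adjointness. -/
lemma QuantumOperation.map_mem_posCone (Φ : QuantumOperation H K) {A : TraceClass H}
    (hA : A ∈ posCone H) : Φ.toLinearMap A ∈ posCone K := by
  have hA' : (A : H →L[ℂ] H).IsPositive := hA
  have h1 := Φ.completelyPositive 1 (fun _ _ => A) (fun x => by
    simpa using hA'.inner_nonneg_right (x 0))
  show (Φ.toLinearMap A : K →L[ℂ] K).IsPositive
  rw [ContinuousLinearMap.isPositive_iff_complex]
  intro x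
  have h2 := h1 (fun _ => x)
  simp only [Finset.univ_unique, Finset.sum_singleton] at h2
  rw [Complex.le_def] at h2
  have h3 : ⟪(Φ.toLinearMap A : K →L[ℂ] K) x, x⟫_ℂ = ⟪x, (Φ.toLinearMap A : K →L[ℂ] K) x⟫_ℂ := by
    rw [← inner_conj_symm, Complex.conj_eq_iff_im]
    exact h2.2.symm
  rw [h3]
  refine ⟨Complex.ext ?_ ?_, ?_⟩
  · simp
  · simpa using h2.2
  · simpa using h2.1

/-! ### Arithmetic of upper limits -/

lemma limsup_coe_ennreal (u : ℕ → ℝ≥0∞) :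
    limsup (fun n => (u n : EReal)) atTop = ((limsup u atTop : ℝ≥0∞) : EReal) :=
  (Monotone.map_limsup_of_continuousAt (f := ((↑) : ℝ≥0∞ → EReal))
    (fun _ _ h => EReal.coe_ennreal_le_coe_ennreal_iff.2 h) u
    continuous_coe_ennreal_ereal.continuousAt).symm

/-- Finiteness of `c₀` excludes `∞ - ∞` in the limit, so `u` may have an infinite upper limit. -/
lemma limsup_sub_of_tendsto {u : ℕ → EReal} {c : ℕ → ℝ≥0∞} {c₀ : ℝ≥0∞} (hc₀ : c₀ ≠ ⊤)
    (hc : Tendsto c atTop (𝓝 c₀)) :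
    limsup (fun n => u n - (c n : EReal)) atTop = limsup u atTop - (c₀ : EReal) := by
  have h1 : Tendsto (fun n => -(c n : EReal)) atTop (𝓝 (-(c₀ : EReal))) :=
    (EReal.tendsto_coe_ennreal.2 hc).neg
  have hbot : -(c₀ : EReal) ≠ ⊥ := by
    rw [Ne, EReal.neg_eq_bot_iff]
    simpa using hc₀
  have htop : -(c₀ : EReal) ≠ ⊤ := by
    rw [Ne, EReal.neg_eq_top_iff]
    simp
  refine le_antisymm ?_ ?_
  · have := EReal.limsup_add_le (f := atTop) (u := u) (v := fun n => -(c n : EReal))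
      (Or.inr (by rwa [h1.limsup_eq])) (Or.inr (by rwa [h1.limsup_eq]))
    rw [h1.limsup_eq] at this
    exact this
  · have := EReal.le_limsup_add (f := atTop) (u := u) (v := fun n => -(c n : EReal))
    rw [h1.liminf_eq] at this
    exact this

end

end EntropyLoss

/-! ### Assembly of statements A and B -/

open EntropyLoss in
theorem proposition3
    {H : Type*} [NormedAddCommGroup H] [InnerProductSpace ℂ H] [CompleteSpace H]
    [TopologicalSpace.SeparableSpace H]
    {K : Type*} [NormedAddCommGroup K] [InnerProductSpace ℂ K] [CompleteSpace K]
    [TopologicalSpace.SeparableSpace K]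
    (ρ : ℕ → EntropyLoss.TraceClass H) (ρ₀ : EntropyLoss.TraceClass H)
    (hρ : ∀ n, ρ n ∈ EntropyLoss.posCone H) (hρ₀ : ρ₀ ∈ EntropyLoss.posCone H)
    (hlim : EntropyLoss.TraceTendsto ρ ρ₀) :
    (EntropyLoss.entropy ρ₀ ≠ ⊤ →
      (∀ k : ℕ, 1 ≤ k →
        EntropyLoss.entropyJump ρ ρ₀ =
          limsup (fun n => EntropyLoss.gap k (ρ n)) atTop - EntropyLoss.gap k ρ₀) ∧
      Tendsto (fun k : ℕ => limsup (fun n => EntropyLoss.gap k (ρ n)) atTop) atTop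
        (𝓝 (EntropyLoss.entropyJump ρ ρ₀)) ∧
      EntropyLoss.entropyJump ρ ρ₀ =
        ⨅ (k : ℕ) (_ : 1 ≤ k), limsup (fun n => EntropyLoss.gap k (ρ n)) atTop) ∧
    (∀ (Φ : ℕ → EntropyLoss.QuantumOperation H K) (Φ₀ : EntropyLoss.QuantumOperation H K) (m : ℕ),
      (∀ n, EntropyLoss.choiRank (Φ n) ≤ (m : ℕ∞)) →
      EntropyLoss.TraceTendsto (fun n => (Φ n).toLinearMap (ρ n)) (Φ₀.toLinearMap ρ₀) →
      EntropyLoss.entropyJump (fun n => (Φ n).toLinearMap (ρ n)) (Φ₀.toLinearMap ρ₀) ≤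
        EntropyLoss.entropyJump ρ ρ₀) := by
  have hρt : ∀ n, posTrace (ρ n : H →L[ℂ] H) < ⊤ := fun n => posTrace_lt_top_of_mem (ρ n).2
  have hρ₀t : posTrace (ρ₀ : H →L[ℂ] H) < ⊤ := posTrace_lt_top_of_mem ρ₀.2
  constructor
  · intro hfin
    set L := limsup (fun n => (entropy (ρ n) : EReal)) atTop with hL
    have hjump : entropyJump ρ ρ₀ = L - (entropy ρ₀ : EReal) := if_neg hfin
    have hcfin : ∀ k, approximator k ρ₀ ≠ ⊤ := fun k =>
      ne_top_of_le_ne_top hfin (by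
        rw [approximator_eq_appr k hρ₀]; exact appr_le_ent k hρ₀ hρ₀t)
    have hgap : ∀ k, 1 ≤ k → limsup (fun n => gap k (ρ n)) atTop =
        L - (approximator k ρ₀ : EReal) := by
      intro k hk
      refine limsup_sub_of_tendsto (hcfin k) ?_
      rw [approximator_eq_appr k hρ₀]
      simp_rw [approximator_eq_appr k (hρ _)]
      exact tendsto_appr_of_tendsto hk hρ hρ₀ hρ₀t hlim
    have hlimit : Tendsto (fun k : ℕ => limsup (fun n => gap k (ρ n)) atTop) atTop
        (𝓝 (entropyJump ρ ρ₀)) := by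
      rw [hjump]
      have h1 : Tendsto (fun k => -(approximator k ρ₀ : EReal)) atTop
          (𝓝 (-(entropy ρ₀ : EReal))) := by
        refine (EReal.tendsto_coe_ennreal.2 ?_).neg
        simp_rw [approximator_eq_appr _ hρ₀]
        exact tendsto_appr hρ₀ hρ₀t
      have h2 : ContinuousAt (fun p : EReal × EReal => p.1 + p.2) (L, -(entropy ρ₀ : EReal)) :=
        EReal.continuousAt_add (Or.inr (by
          rw [Ne, EReal.neg_eq_bot_iff]; simpa using hfin)) (Or.inr (by
          rw [Ne, EReal.neg_eq_top_iff]; simp))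
      have h3 := h2.tendsto.comp ((tendsto_const_nhds (x := L)).prodMk_nhds h1)
      refine h3.congr' ?_
      filter_upwards [eventually_ge_atTop 1] with k hk
      rw [hgap k hk]
      rfl
    refine ⟨fun k hk => ?_, hlimit, le_antisymm (le_iInf₂ fun k hk => ?_) ?_⟩
    · rw [hgap k hk, hjump, gap]
      -- The identity is `(L - c) - (e - c) = L - e` with `c` and `e` finite; for `L = ⊤` both sides
      -- are `⊤`.
      have hL0 : L ≠ ⊥ := by
        rw [hL, limsup_coe_ennreal]; simp
      lift entropy ρ₀ to ℝ≥0 using hfin with e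
      lift approximator k ρ₀ to ℝ≥0 using hcfin k with c
      clear_value L
      induction L with
      | bot => exact absurd rfl hL0
      | top => rfl
      | coe x =>
        simp only [EReal.coe_nnreal_eq_coe_real]
        norm_cast
        ring
    · rw [hgap k hk, hjump]
      refine EReal.sub_le_sub le_rfl ?_
      rw [EReal.coe_ennreal_le_coe_ennreal_iff, approximator_eq_appr k hρ₀]
      exact appr_le_ent k hρ₀ hρ₀t
    · refine ge_of_tendsto hlimit ?_
      filter_upwards [eventually_ge_atTop 1] with k hk
      exact iInf₂_le k hk
  · intro Φ Φ₀ m hm hΦlim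
    by_cases hfin : entropy ρ₀ = ⊤
    · rw [entropyJump, entropyJump, if_pos hfin]
      exact le_top
    choose d hd hst using fun n => exists_hasStinespring_of_choiRank_le (hm n)
    choose V hV hΦ using fun n => exists_krausMap_of_hasStinespring (hst n)
    have hS₀ : Φ₀.toLinearMap ρ₀ ∈ posCone K := Φ₀.map_mem_posCone hρ₀
    have hS₀t := posTrace_lt_top_of_mem (Φ₀.toLinearMap ρ₀).2
    have hS : Tendsto (fun n => traceNorm (krausMap (V n) (ρ n : H →L[ℂ] H) -
        (Φ₀.toLinearMap ρ₀ : K →L[ℂ] K))) atTop (𝓝 0) := by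
      simp_rw [← hΦ]
      exact hΦlim
    have hmain := ent_add_limsup_ent_krausMap_le hρ hρt hρ₀ hρ₀t
      hfin hlim hd hV hS₀ hS₀t hS
    have hlsc := ent_le_limsup_of_krausMap hρ hρt hρ₀ hlim hd hV hS₀ hS₀t hS
    simp_rw [← hΦ, ← entropy_eq_ent] at hmain hlsc
    rw [entropyJump, entropyJump, if_neg hfin, limsup_coe_ennreal, limsup_coe_ennreal]
    generalize limsup (fun n => entropy (ρ n)) atTop = LA at hmain hlsc ⊢
    generalize limsup (fun n => entropy ((Φ n).toLinearMap (ρ n))) atTop = LS at hmain ⊢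
    -- If the input entropies have infinite upper limit the right side is `⊤`. Otherwise all four
    -- quantities are finite, and the additive inequality can be rearranged in the reals.
    rcases eq_or_ne LA ⊤ with hLA | hLA
    · rw [hLA]
      lift entropy ρ₀ to ℝ≥0 using hfin with e
      simp
    have hS₀fin : entropy (Φ₀.toLinearMap ρ₀) ≠ ⊤ := by
      refine ne_top_of_le_ne_top ?_ hlsc
      exact ENNReal.add_ne_top.2 ⟨hLA, ENNReal.mul_ne_top
        (ENNReal.add_ne_top.2 ⟨hρ₀t.ne, by simp⟩) (cost_inv_succ_ne_top m)⟩
    rw [if_neg hS₀fin]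
    have hLS : LS ≠ ⊤ := by
      refine ne_top_of_le_ne_top (ENNReal.add_ne_top.2 ⟨hS₀fin, hLA⟩) (le_trans ?_ hmain)
      exact le_add_self
    lift entropy ρ₀ to ℝ≥0 using hfin with e
    lift entropy (Φ₀.toLinearMap ρ₀) to ℝ≥0 using hS₀fin with e'
    lift LA to ℝ≥0 using hLA
    lift LS to ℝ≥0 using hLS
    have hmain' : (e : ℝ) + LS ≤ e' + LA := by exact_mod_cast hmain
    simp only [EReal.coe_nnreal_eq_coe_real]
    norm_cast
    linarith
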